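/- Let $n,m\in\mathbb N$, $T\in(0,\infty)$, let $W$ be an $m$-dimensional Brownian motion on $[0,T]$ on a probability space $(\Omega,\mathcal F,P)$, and let $(\mathcal F_s)_{s\in[0,T]}$ be the augmented natural filtration of $W$. Let $O\in\mathbb R^{n\times n}$ be orthogonal, $\lambda_1,\dots,\lambda_n>0$, and $\gamma^{\alpha}=O^\top\operatorname{diag}(\lambda_1^\alpha,\dots,\lambda_n^\alpha)O$ for $\alpha\in\mathbb R$, $\gamma=\gamma^1$. Let $\rho\in\mathbb R^{n\times n}$ be symmetric positive definite with $\rho\gamma=\gamma\rho$, let $x,d\in\mathbb R^n$ with $d\neq\gamma x$, and let $\nu(s)=e^{s\rho}$ and $\kappa=\tfrac12\big(\gamma^{-1/2}\rho\gamma^{1/2}+\gamma^{1/2}\rho^\top\gamma^{-1/2}\big)$. For a progressively measurable $X=(X(s))_{s\in[0,T]}$ with values in $\mathbb R^n$ and $\int_0^T\|X(s)\|^2ds<\infty$ a.s., its deviation is $$D^X(r)=\gamma X(r)+\nu(r)^{-1}\Big(d-\gamma x-\int_0^r\nu(s)\rho\gamma X(s)\,ds\Big),\quad r\in[0,T].$$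 Let $\mathcal A^{pm}_0(x,d)$ be the set of such $X$ (with $X(0-)=x$) that satisfy $X(T)=0$ a.s. and $E\big[\int_0^T\|\gamma^{-1/2}D^X(s)\|^2ds\big]<\infty$, and define on it $$J^{pm}(X)=\tfrac12E\big[D^X(T)^\top\gamma^{-1}D^X(T)\,\big|\,\mathcal F_0\big]+E\Big[\int_0^TD^X(s)^\top\gamma^{-1/2}\kappa\gamma^{-1/2}D^X(s)\,ds\,\Big|\,\mathcal F_0\Big]-\tfrac12d^\top\gamma^{-1}d .$$ Let $\mathcal A^{fv}_0(x,d)$ be the set of adapted càdlàg finite-variation processes $X$ with $X(0-)=x$ and $X(T)=0$ such that the càdlàg finite-variation solution $D$ of $dD(s)=-\rho D(s)\,ds+\gamma\,dX(s)$ on $[0,T]$, $D(0-)=d$ (a jump of $X$ at time $0$ included), satisfies $E\big[\int_0^T\|\gamma^{-1/2}D(s)\|^2ds\big]<\infty$. Then there is a minimizer $X^*$ of $J^{pm}$ over $\mathcal A^{pm}_0(x,d)$ (that is, $J^{pm}(X^*)\le J^{pm}(Y)$ a.s. for all $Y\in\mathcal A^{pm}_0(x,d)$); it is unique up to $dP\times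 ds|_{[0,T]}$-null sets; $X^*\in\mathcal A^{fv}_0(x,d)$; its deviation $D^*=D^{X^*}$ also solves $dD^*(s)=-\rho D^*(s)\,ds+\gamma\,dX^*(s)$, $D^*(0-)=d$; and $$X^*(s)=\big(I_n+(T-s)\rho\big)\big(2I_n+T\rho\big)^{-1}\big(x-\gamma^{-1}d\big),\quad s\in[0,T),$$ $$D^*(s)=\gamma^{1/2}\big(2I_n+T\rho\big)^{-1}\big(\gamma^{-1/2}d-\gamma^{1/2}x\big),\quad s\in[0,T),$$ $$D^*(T)=2\gamma^{1/2}\big(2I_n+T\rho\big)^{-1}\big(\gamma^{-1/2}d-\gamma^{1/2}x\big).$$ -/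

import Mathlib

namespace ObizhaevaWang

open MeasureTheory ProbabilityTheory
open scoped Matrix ENNReal

/-- `ℝⁿ`. Squared Euclidean norms are written `v ⬝ᵥ v`. -/
abbrev Vec (n : ℕ) : Type := Fin n → ℝ

/-- `ℝⁿˣⁿ`. -/
abbrev Mat (n : ℕ) : Type := Matrix (Fin n) (Fin n) ℝ

/-! ### Liquidity parameters -/

/-- The price impact matrix `γ = Oᵀ diag(λ₁, …, λₙ) O`. -/
def impact {n : ℕ} (O : Mat n) (lam : Vec n) : Mat n :=
  Oᵀ * Matrix.diagonal lam * O

/-- The power `γ^α = Oᵀ diag(λ₁^α, …, λₙ^α) O`. -/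
noncomputable def impactPow {n : ℕ} (O : Mat n) (lam : Vec n) (α : ℝ) : Mat n :=
  Oᵀ * Matrix.diagonal (fun j => lam j ^ α) * O

/-- The solution `ν` of `dν(s) = ν(s) ρ ds`, `ν(0) = I`, for a constant matrix `ρ`. -/
noncomputable def nu {n : ℕ} (ρ : Mat n) (s : ℝ) : Mat n :=
  NormedSpace.exp (s • ρ)

theorem nu_zero {n : ℕ} (ρ : Mat n) : nu ρ 0 = 1 := by
  simp [nu]

attribute [local instance] Matrix.linftyOpNormedRing Matrix.linftyOpNormedAlgebra in
theorem hasDerivAt_nu {n : ℕ} (ρ : Mat n) (s : ℝ) :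
    HasDerivAt (nu ρ) (nu ρ s * ρ) s :=
  hasDerivAt_exp_smul_const ρ s

/-- `κ = ½ γ^{-1/2} ρ γ^{1/2} + ½ γ^{1/2} ρᵀ γ^{-1/2}` (price impact without drift and
volatility). -/
noncomputable def kappa {n : ℕ} (O : Mat n) (lam : Vec n) (ρ : Mat n) : Mat n :=
  (1 / 2 : ℝ) • (impactPow O lam (-(1 / 2)) * ρ * impactPow O lam (1 / 2)) +
    (1 / 2 : ℝ) • (impactPow O lam (1 / 2) * ρᵀ * impactPow O lam (-(1 / 2)))

/-! ### Time interval, processes and the Brownian filtration -/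

/-- The time interval `[0,T]`. -/
abbrev Time (T : ℝ) : Type := Set.Icc (0 : ℝ) T

/-- The initial time `0`. -/
def startTime {T : ℝ} (hT : 0 < T) : Time T := ⟨0, le_rfl, hT.le⟩

/-- The terminal time `T`. -/
def endTime {T : ℝ} (hT : 0 < T) : Time T := ⟨T, hT.le, le_rfl⟩

/-- `W` is an `m`-dimensional Brownian motion on `[0,T]` with respect to the filtration `𝓕`. -/
structure IsBrownianMotion {Ω : Type*} {mΩ : MeasurableSpace Ω} (P : Measure Ω) {T : ℝ}
    (hT : 0 < T) (𝓕 : Filtration (Time T) mΩ) {m : ℕ} (W : Time T → Ω → Vec m) : Prop where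
  adapted : ∀ t, Measurable[𝓕 t] (W t)
  start : ∀ᵐ ω ∂P, W (startTime hT) ω = 0
  continuous : ∀ᵐ ω ∂P, Continuous fun t => W t ω
  indep : ∀ s t, s ≤ t →
    Indep (MeasurableSpace.comap (fun ω => W t ω - W s ω) inferInstance) (𝓕 s) P
  law : ∀ s t, s ≤ t → P.map (fun ω => W t ω - W s ω) =
    Measure.pi fun _ => gaussianReal 0 (Real.toNNReal ((t : ℝ) - (s : ℝ)))

/-- `𝓕` is the natural filtration of `W`, augmented by all `P`-null sets. -/
def IsAugmentedNaturalFiltration {Ω : Type*} {mΩ : MeasurableSpace Ω} (P : Measure Ω) {T : ℝ}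
    (𝓕 : Filtration (Time T) mΩ) {m : ℕ} (W : Time T → Ω → Vec m) : Prop :=
  ∀ t, (𝓕 t : MeasurableSpace Ω) =
    (⨆ s ≤ t, MeasurableSpace.comap (W s) inferInstance) ⊔
      MeasurableSpace.generateFrom {N | P N = 0}

/-- The path `s ↦ X(s, ω)` as a function of real time, constant outside `[0,T]`. Only its values
on `[0,T]` enter integrals over subintervals of `[0,T]`. -/
noncomputable def path {Ω : Type*} {T : ℝ} (hT : 0 < T) {n : ℕ} (X : Time T → Ω → Vec n)
    (ω : Ω) : ℝ → Vec n :=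
  Set.IccExtend hT.le fun s => X s ω

/-- The integrability condition `E[∫₀ᵀ ‖γ^{-1/2} D(s)‖² ds] < ∞`. -/
def SquareIntegrableDeviation {Ω : Type*} {mΩ : MeasurableSpace Ω} (P : Measure Ω) {T : ℝ}
    (hT : 0 < T) {n : ℕ} (O : Mat n) (lam : Vec n) (D : Time T → Ω → Vec n) : Prop :=
  ∫⁻ ω, (∫⁻ s in Set.Icc (0 : ℝ) T, ENNReal.ofReal
    ((impactPow O lam (-(1 / 2)) *ᵥ path hT D ω s) ⬝ᵥ
      (impactPow O lam (-(1 / 2)) *ᵥ path hT D ω s))) ∂P < ∞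

/-! ### Progressively measurable strategies -/

/-- The deviation process of a progressively measurable strategy with initial position `x` and
initial deviation `d`,
`D(r) = γ X(r) + ν⁻¹(r) (d - γ x - ∫₀ʳ (d(ν(s) γ)) X(s))`, where `d(ν(s) γ) = ν(s) ρ γ ds`. -/
noncomputable def deviation {Ω : Type*} {T : ℝ} (hT : 0 < T) {n : ℕ} (O : Mat n) (lam : Vec n)
    (ρ : Mat n) (x d : Vec n) (X : Time T → Ω → Vec n) (r : Time T) (ω : Ω) : Vec n :=
  impact O lam *ᵥ X r ω + (nu ρ r)⁻¹ *ᵥ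
    (d - impact O lam *ᵥ x - ∫ s in (0 : ℝ)..r, (nu ρ s * ρ * impact O lam) *ᵥ path hT X ω s)

/-- The set `𝒜₀^{pm}(x,d)` of progressively measurable strategies with terminal target `0`. The
prescribed value `X(0-) = x` enters through the deviation. -/
structure IsPMStrategy {Ω : Type*} {mΩ : MeasurableSpace Ω} (P : Measure Ω) {T : ℝ}
    (hT : 0 < T) (𝓕 : Filtration (Time T) mΩ) {n : ℕ} (O : Mat n) (lam : Vec n) (ρ : Mat n)
    (x d : Vec n) (X : Time T → Ω → Vec n) : Prop where
  progressive : IsStronglyProgressive 𝓕 X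
  square_integrable : ∀ᵐ ω ∂P,
    ∫⁻ s in Set.Icc (0 : ℝ) T, ENNReal.ofReal (path hT X ω s ⬝ᵥ path hT X ω s) < ∞
  terminal : ∀ᵐ ω ∂P, X (endTime hT) ω = 0
  deviation_integrable :
    SquareIntegrableDeviation P hT O lam (deviation hT O lam ρ x d X)

/-- The cost functional
`J^{pm}(x,d,X) = ½ E₀[D(T)ᵀ γ⁻¹ D(T)] + E₀[∫₀ᵀ D(s)ᵀ γ^{-1/2} κ γ^{-1/2} D(s) ds] - ½ dᵀ γ⁻¹ d`
(no risk term), a random variable, `E₀` being the conditional expectation given `𝓕₀`. -/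
noncomputable def costPM {Ω : Type*} {mΩ : MeasurableSpace Ω} (P : Measure Ω) {T : ℝ}
    (hT : 0 < T) (𝓕 : Filtration (Time T) mΩ) {n : ℕ} (O : Mat n) (lam : Vec n) (ρ : Mat n)
    (x d : Vec n) (X : Time T → Ω → Vec n) (ω : Ω) : ℝ :=
  let D := deviation hT O lam ρ x d X
  (1 / 2) * (P[fun ω' => D (endTime hT) ω' ⬝ᵥ (impactPow O lam (-1) *ᵥ D (endTime hT) ω') |
      𝓕 (startTime hT)]) ω +
    (P[fun ω' => ∫ s in (0 : ℝ)..T, path hT D ω' s ⬝ᵥ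
      ((impactPow O lam (-(1 / 2)) * kappa O lam ρ * impactPow O lam (-(1 / 2))) *ᵥ
        path hT D ω' s) | 𝓕 (startTime hT)]) ω -
    (1 / 2) * (d ⬝ᵥ (impactPow O lam (-1) *ᵥ d))

/-- `X` minimizes `J^{pm}` over `𝒜₀^{pm}(x,d)`. -/
def IsOptimalPM {Ω : Type*} {mΩ : MeasurableSpace Ω} (P : Measure Ω) {T : ℝ}
    (hT : 0 < T) (𝓕 : Filtration (Time T) mΩ) {n : ℕ} (O : Mat n) (lam : Vec n) (ρ : Mat n)
    (x d : Vec n) (X : Time T → Ω → Vec n) : Prop :=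
  IsPMStrategy P hT 𝓕 O lam ρ x d X ∧
    ∀ Y, IsPMStrategy P hT 𝓕 O lam ρ x d Y →
      costPM P hT 𝓕 O lam ρ x d X ≤ᵐ[P] costPM P hT 𝓕 O lam ρ x d Y

/-! ### Finite-variation strategies -/

/-- The path of `X` preceded by the value `X(0-) = x` at all negative times, so that a jump of
size `X(0) - x` at time `0` is part of the path. -/
noncomputable def pathFrom {Ω : Type*} {T : ℝ} (hT : 0 < T) {n : ℕ} (x : Vec n)
    (X : Time T → Ω → Vec n) (ω : Ω) : ℝ → Vec n :=
  fun s => if s < 0 then x else path hT X ω s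

/-- `X` is an adapted càdlàg finite-variation process with `X(0-) = x`. The left limits exist
because the paths have bounded variation. -/
structure IsCadlagFV {Ω : Type*} {mΩ : MeasurableSpace Ω} {T : ℝ} (hT : 0 < T)
    (𝓕 : Filtration (Time T) mΩ) {n : ℕ} (x : Vec n) (X : Time T → Ω → Vec n) : Prop where
  adapted : ∀ t, Measurable[𝓕 t] (X t)
  right_continuous : ∀ ω s, ContinuousWithinAt (pathFrom hT x X ω) (Set.Ici s) s
  finite_variation : ∀ ω, BoundedVariationOn (pathFrom hT x X ω) Set.univ

open Classical in
/-- The Lebesgue–Stieltjes integral `∫_S A(s) df(s)` of a matrix-valued integrand against a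
function `f` of bounded variation; jumps of `f` at points of `S` contribute. -/
noncomputable def stieltjesIntegral {n : ℕ} (S : Set ℝ) (A : ℝ → Mat n) (f : ℝ → Vec n) : Vec n :=
  if h : BoundedVariationOn f Set.univ then
    ∫ᵛ s in S, LinearMap.toContinuousLinearMap (Matrix.mulVecLin (A s))
      ∂[ContinuousLinearMap.id ℝ (Vec n →L[ℝ] Vec n); h.vectorMeasure]
  else 0

/-- `D` is the càdlàg finite-variation solution of
`dD(s) = -ρ D(s) ds + γ dX(s)`, `s ∈ [0,T]`, `D(0-) = d`. -/
def IsDeviationFV {Ω : Type*} {mΩ : MeasurableSpace Ω} {T : ℝ} (hT : 0 < T)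
    (𝓕 : Filtration (Time T) mΩ) {n : ℕ} (O : Mat n) (lam : Vec n) (ρ : Mat n)
    (x d : Vec n) (X D : Time T → Ω → Vec n) : Prop :=
  IsCadlagFV hT 𝓕 d D ∧
    ∀ ω (r : Time T), D r ω = d - (∫ s in (0 : ℝ)..r, ρ *ᵥ path hT D ω s) +
      stieltjesIntegral (Set.Icc 0 (r : ℝ)) (fun _ => impact O lam) (pathFrom hT x X ω)

/-- The set `𝒜₀^{fv}(x,d)` of finite-variation strategies with terminal target `0`. (The second
integrability condition of the general model, which involves the volatility of the price impact,
is void for constant price impact.) -/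
structure IsFVStrategy {Ω : Type*} {mΩ : MeasurableSpace Ω} (P : Measure Ω) {T : ℝ}
    (hT : 0 < T) (𝓕 : Filtration (Time T) mΩ) {n : ℕ} (O : Mat n) (lam : Vec n) (ρ : Mat n)
    (x d : Vec n) (X : Time T → Ω → Vec n) : Prop where
  cadlagFV : IsCadlagFV hT 𝓕 x X
  terminal : ∀ ω, X (endTime hT) ω = 0
  deviation_integrable : ∃ D, IsDeviationFV hT 𝓕 O lam ρ x d X D ∧
    SquareIntegrableDeviation P hT O lam D

end ObizhaevaWang

namespace ObizhaevaWang

open MeasureTheory ProbabilityTheory Filter Topology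
open scoped Matrix ENNReal

/-! ### Powers of the price impact matrix -/

section Impact

variable {n : ℕ} {O : Mat n} {lam : Vec n} {ρ : Mat n}

/-! The problem reduces, path by path, to minimizing a strictly convex quadratic functional.
Integrating by parts in the formula for the deviation gives `D(r) = γ X(r) + d - γ x - ∫₀ʳ ρ D(s)
ds` for strategies that are merely integrable in time (`pathDeviation_eq`). With `X(T) = 0` and `z =
γ^{-1/2} D`, and since `ρ` commutes with every power of `γ`, the terminal value is `γ^{-1/2} D(T) =
b - ρ ∫ z`, where `b = γ^{-1/2} (d - γ x)` (`scaledDeviation_end`). Moreover `κ = ρ` (`kappa_eq`),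
so up to a constant the cost is the conditional expectation of `½ |b - ρ ∫ z|² + ∫ z · ρ z`, in
which `X` appears only through `z`.

Let `c` solve `(2 I + T ρ) c = b`. Completing the square (`cost_eq_add_excess`) turns this
expression into a constant plus `½ |ρ (∫ z - T c)|² + ∫ (z - c) · ρ (z - c)`, the `excess`. It is
nonnegative and, `ρ` being positive definite, vanishes only if `z = c` almost everywhere on `[0,T]`.

The explicit candidate has scaled deviation `c` on `[0, T)` (`deviation_optimalStrategy`), hence
zero excess, hence minimal cost. Conversely a minimizer has excess of zero expectation, so its
scaled deviation is `c` almost everywhere; the integrated equation then recovers `γ X` from `D`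
(`path_ae_eq_of_scaledDeviation_ae_eq`), which gives uniqueness. For the finite-variation claims,
the Stieltjes integral of the constant `γ` telescopes to `γ (X(r) - x)`, so the same integrated
equation is the required dynamics. -/

theorem impactPow_one (O : Mat n) (lam : Vec n) : impactPow O lam 1 = impact O lam := by
  simp [impactPow, impact]

theorem transpose_impactPow (O : Mat n) (lam : Vec n) (α : ℝ) :
    (impactPow O lam α)ᵀ = impactPow O lam α := by
  simp [impactPow, Matrix.transpose_mul, Matrix.mul_assoc]

theorem mul_transpose_of_orthogonal (hO : O ∈ Matrix.orthogonalGroup (Fin n) ℝ) :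
    O * Oᵀ = 1 := by
  simpa [Matrix.star_eq_conjTranspose] using Matrix.mem_orthogonalGroup_iff (Fin n) ℝ |>.1 hO

theorem transpose_mul_of_orthogonal (hO : O ∈ Matrix.orthogonalGroup (Fin n) ℝ) :
    Oᵀ * O = 1 := by
  simpa [Matrix.star_eq_conjTranspose] using Matrix.mem_orthogonalGroup_iff' (Fin n) ℝ |>.1 hO

theorem impactPow_zero (hO : O ∈ Matrix.orthogonalGroup (Fin n) ℝ) (lam : Vec n) :
    impactPow O lam 0 = 1 := by
  simp [impactPow, transpose_mul_of_orthogonal hO]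

theorem impactPow_mul (hO : O ∈ Matrix.orthogonalGroup (Fin n) ℝ) (hlam : ∀ j, 0 < lam j)
    (α β : ℝ) : impactPow O lam α * impactPow O lam β = impactPow O lam (α + β) := by
  have h : impactPow O lam α * impactPow O lam β = Oᵀ * (Matrix.diagonal (fun j => lam j ^ α) *
      (O * Oᵀ) * Matrix.diagonal (fun j => lam j ^ β)) * O := by
    simp only [impactPow, Matrix.mul_assoc]
  rw [h, mul_transpose_of_orthogonal hO, Matrix.mul_one, Matrix.diagonal_mul_diagonal]
  simp [impactPow, Real.rpow_add (hlam _)]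

/-- A matrix commuting with `γ` commutes with all powers of `γ`. -/
theorem commute_impactPow (hO : O ∈ Matrix.orthogonalGroup (Fin n) ℝ)
    (hcomm : ρ * impact O lam = impact O lam * ρ) (α : ℝ) :
    Commute ρ (impactPow O lam α) := by
  have h1 := mul_transpose_of_orthogonal hO
  have h2 := transpose_mul_of_orthogonal hO
  set σ : Mat n := O * ρ * Oᵀ with hσ
  have key : σ * Matrix.diagonal lam = Matrix.diagonal lam * σ := by
    calc σ * Matrix.diagonal lam = O * ρ * Oᵀ * Matrix.diagonal lam * (O * Oᵀ) := by
          rw [h1, Matrix.mul_one]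
      _ = O * (ρ * impact O lam) * Oᵀ := by simp only [impact, Matrix.mul_assoc]
      _ = O * (impact O lam * ρ) * Oᵀ := by rw [hcomm]
      _ = (O * Oᵀ) * Matrix.diagonal lam * (O * ρ * Oᵀ) := by
          simp only [impact, Matrix.mul_assoc]
      _ = _ := by rw [h1, Matrix.one_mul]
  -- In the eigenbasis of `γ`, commutation says `σ i j * lam j = lam i * σ i j`. So `σ i j` can be
  -- nonzero only where the two eigenvalues agree, and there their powers agree too.
  have key2 : σ * Matrix.diagonal (fun j => lam j ^ α) =
      Matrix.diagonal (fun j => lam j ^ α) * σ := by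
    ext i j
    have hij := congrFun (congrFun key i) j
    rw [Matrix.mul_diagonal, Matrix.diagonal_mul] at hij ⊢
    by_cases hz : σ i j = 0
    · simp [hz]
    · have : lam j = lam i := by
        rw [mul_comm] at hij
        exact mul_right_cancel₀ hz hij
      rw [this, mul_comm]
  have hρ : ρ = Oᵀ * σ * O := by
    calc ρ = (Oᵀ * O) * ρ * (Oᵀ * O) := by rw [h2, Matrix.one_mul, Matrix.mul_one]
      _ = _ := by simp only [hσ, Matrix.mul_assoc]
  show ρ * _ = _ * ρ
  calc ρ * impactPow O lam α
      = Oᵀ * (σ * (O * Oᵀ) * Matrix.diagonal (fun j => lam j ^ α)) * O := by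
        conv_lhs => rw [hρ]
        simp only [impactPow, Matrix.mul_assoc]
    _ = Oᵀ * (Matrix.diagonal (fun j => lam j ^ α) * (O * Oᵀ) * σ) * O := by
        rw [h1, Matrix.mul_one, Matrix.mul_one, key2]
    _ = impactPow O lam α * ρ := by
        conv_rhs => rw [hρ]
        simp only [impactPow, Matrix.mul_assoc]

/-- If `ρ` is symmetric and commutes with `γ`, then `κ = ρ`. -/
theorem kappa_eq (hO : O ∈ Matrix.orthogonalGroup (Fin n) ℝ) (hlam : ∀ j, 0 < lam j)
    (hcomm : ρ * impact O lam = impact O lam * ρ) (hsymm : ρᵀ = ρ) :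
    kappa O lam ρ = ρ := by
  have h := commute_impactPow hO hcomm
  rw [kappa, hsymm, ← (h (-(1 / 2))).eq, ← (h (1 / 2)).eq, Matrix.mul_assoc, Matrix.mul_assoc,
    impactPow_mul hO hlam, impactPow_mul hO hlam, neg_add_cancel, add_neg_cancel,
    impactPow_zero hO, Matrix.mul_one, ← add_smul]
  norm_num

theorem transpose_eq_of_posDef (hρ : ρ.PosDef) : ρᵀ = ρ := by
  simpa [Matrix.IsHermitian] using hρ.isHermitian

/-- The matrix `2 I + T ρ` is invertible. -/
theorem isUnit_det_two_add_smul (hρ : ρ.PosDef) {T : ℝ} (hT : 0 < T) :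
    IsUnit ((2 : ℝ) • (1 : Mat n) + T • ρ).det := by
  have : ((2 : ℝ) • (1 : Mat n) + T • ρ).PosDef :=
    (Matrix.PosDef.one.smul two_pos).add (hρ.smul hT)
  exact (Matrix.isUnit_iff_isUnit_det _).1 this.isUnit

end Impact

/-! ### The matrix exponential -/

section Nu

variable {n : ℕ}

theorem inv_nu (ρ : Mat n) (s : ℝ) : (nu ρ s)⁻¹ = nu ρ (-s) := by
  simp [nu, Matrix.exp_neg]

theorem nu_neg_mul_nu (ρ : Mat n) (s : ℝ) : nu ρ (-s) * nu ρ s = 1 := by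
  rw [← inv_nu]
  apply Matrix.nonsing_inv_mul
  exact (Matrix.isUnit_iff_isUnit_det _).1 (Matrix.isUnit_exp _)

theorem commute_nu {ρ A : Mat n} (h : Commute ρ A) (s : ℝ) : Commute (nu ρ s) A :=
  (h.smul_left s).exp_left

attribute [local instance] Matrix.linftyOpNormedRing Matrix.linftyOpNormedAlgebra in
theorem hasDerivAt_nu_apply (ρ : Mat n) (s : ℝ) (i j : Fin n) :
    HasDerivAt (fun t => nu ρ t i j) ((nu ρ s * ρ) i j) s := by
  exact (LinearMap.toContinuousLinearMap
    (Matrix.entryLinearMap ℝ ℝ i j)).hasFDerivAt.comp_hasDerivAt s (hasDerivAt_nu ρ s)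

theorem continuous_nu (ρ : Mat n) : Continuous (nu ρ) := by
  refine continuous_pi fun i => continuous_pi fun j => ?_
  exact continuous_iff_continuousAt.2 fun s => (hasDerivAt_nu_apply ρ s i j).continuousAt

end Nu

/-! ### Stieltjes integrals of constant matrices -/

section Stieltjes

variable {n : ℕ}

/-- A vector measure with values in `ℝⁿ` has finite variation. -/
theorem isFiniteMeasure_variation {α : Type*} {mα : MeasurableSpace α}
    (μ : VectorMeasure α (Vec n)) : IsFiniteMeasure μ.variation := by
  -- The coordinates are signed measures, whose total variations are finite. The sup norm on `ℝⁿ` is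
  -- at most the sum of the coordinate norms, so the sum of these total variations dominates the
  -- variation of `μ`.
  let c : Fin n → SignedMeasure α := fun i =>
    μ.mapRange (LinearMap.proj (R := ℝ) (φ := fun _ : Fin n => ℝ) i).toAddMonoidHom
      (continuous_apply i)
  refine isFiniteMeasure_of_le (∑ i, (c i).totalVariation) ?_
  refine VectorMeasure.variation_le_of_forall_enorm_le fun E _ => ?_
  have h1 : ‖μ E‖ₑ ≤ ∑ i, ‖μ E i‖ₑ := by
    simp only [enorm_eq_nnnorm]
    rw [← ENNReal.ofNNReal_finsetSum, ENNReal.coe_le_coe]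
    refine pi_nnnorm_le_iff.2 fun i => ?_
    exact Finset.single_le_sum (f := fun i => ‖μ E i‖₊) (fun _ _ => zero_le) (Finset.mem_univ i)
  rw [Measure.finsetSum_apply]
  exact h1.trans (Finset.sum_le_sum fun i _ => (c i).enorm_le_totalVariation E)

/-- The integral of a constant matrix over `[a, b]` against a right-continuous function. -/
theorem stieltjesIntegral_const_Icc (A : Mat n) {f : ℝ → Vec n} {y : Vec n} {a b : ℝ} (hab : a ≤ b)
    (hf : BoundedVariationOn f Set.univ) (hright : ContinuousWithinAt f (Set.Ici b) b)
    (hleft : Tendsto f (𝓝[<] a) (𝓝 y)) :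
    stieltjesIntegral (Set.Icc a b) (fun _ => A) f = A *ᵥ (f b - y) := by
  have := isFiniteMeasure_variation hf.vectorMeasure
  rw [stieltjesIntegral, dif_pos hf, VectorMeasure.integral_const,
    VectorMeasure.restrict_apply _ measurableSet_Icc MeasurableSet.univ, Set.univ_inter,
    hf.vectorMeasure_Icc hab]
  -- The closed interval receives the right limit at `b` minus the left limit at `a`. Hence `y` is
  -- the value before a possible jump at `a`, and that jump is counted.
  rw [leftLim_eq_of_tendsto hleft,
    rightLim_eq_of_tendsto
      (hright.mono_left (nhdsWithin_mono _ Set.Ioi_subset_Ici_self))]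
  simp

end Stieltjes

/-! ### Deterministic strategies that are affine on `[0, T)` -/

section Affine

variable {n : ℕ} {T : ℝ}

/-- The function that equals `a` on `(-∞, 0)`, `p + s w` on `[0, T)` and `q` on `[T, ∞)`. -/
noncomputable def affinePath (T : ℝ) (a p w q : Vec n) (s : ℝ) : Vec n :=
  if s < 0 then a else if s < T then p + s • w else q

theorem continuousWithinAt_affinePath (T : ℝ) (a p w q : Vec n) (s : ℝ) :
    ContinuousWithinAt (affinePath T a p w q) (Set.Ici s) s := by
  rcases lt_or_ge s 0 with h0 | h0
  · refine (continuousWithinAt_const (b := a)).congr_of_eventuallyEq ?_ (by simp [affinePath, h0])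
    filter_upwards [mem_nhdsWithin_of_mem_nhds (Iio_mem_nhds h0)] with y hy
    simp [affinePath, Set.mem_Iio.1 hy]
  · rcases lt_or_ge s T with h1 | h1
    · have hc : ContinuousWithinAt (fun y : ℝ => p + y • w) (Set.Ici s) s := by fun_prop
      refine hc.congr_of_eventuallyEq ?_ (by simp [affinePath, h0.not_gt, h1])
      filter_upwards [mem_nhdsWithin_of_mem_nhds (Iio_mem_nhds h1), self_mem_nhdsWithin]
        with y hy hy'
      simp [affinePath, Set.mem_Iio.1 hy, (h0.trans (Set.mem_Ici.1 hy')).not_gt]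
    · refine (continuousWithinAt_const (b := q)).congr_of_eventuallyEq ?_
        (by simp [affinePath, h0.not_gt, h1.not_gt])
      filter_upwards [self_mem_nhdsWithin] with y hy
      simp [affinePath, (h0.trans (Set.mem_Ici.1 hy)).not_gt, (h1.trans (Set.mem_Ici.1 hy)).not_gt]

theorem tendsto_affinePath_zero_left (T : ℝ) (a p w q : Vec n) :
    Tendsto (affinePath T a p w q) (𝓝[<] 0) (𝓝 a) := by
  refine tendsto_const_nhds.congr' ?_
  filter_upwards [self_mem_nhdsWithin] with y hy
  simp [affinePath, Set.mem_Iio.1 hy]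

theorem boundedVariationOn_smul_const {f : ℝ → ℝ} (hf : BoundedVariationOn f Set.univ) (v : Vec n) :
    BoundedVariationOn (fun s => f s • v) Set.univ :=
  hf.smul (by
    rw [BoundedVariationOn, eVariationOn.constant_on]
    · exact ENNReal.zero_ne_top
    · rintro _ ⟨_, _, rfl⟩ _ ⟨_, _, rfl⟩
      rfl)

theorem boundedVariationOn_add {f g : ℝ → Vec n} (hf : BoundedVariationOn f Set.univ)
    (hg : BoundedVariationOn g Set.univ) : BoundedVariationOn (fun s => f s + g s) Set.univ := by
  refine ne_top_of_le_ne_top (ENNReal.add_ne_top.2 ⟨hf, hg⟩) (iSup_le fun u => ?_)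
  calc _ ≤ ∑ i ∈ Finset.range u.1, (edist (f (u.2.1 (i + 1))) (f (u.2.1 i)) +
          edist (g (u.2.1 (i + 1))) (g (u.2.1 i))) :=
        Finset.sum_le_sum fun i _ => edist_add_add_le _ _ _ _
    _ ≤ _ := by
      rw [Finset.sum_add_distrib]
      exact add_le_add (eVariationOn.sum_le u.2.2.1 u.2.2.2)
        (eVariationOn.sum_le u.2.2.1 u.2.2.2)

theorem boundedVariationOn_step (t : ℝ) :
    BoundedVariationOn (fun s : ℝ => if s < t then (0 : ℝ) else 1) Set.univ := by
  refine MonotoneOn.boundedVariationOn (C := 1) ?_ fun s _ => ?_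
  · intro s _ s' _ h
    dsimp only
    split_ifs <;> linarith
  · split_ifs <;> simp

theorem boundedVariationOn_clamp (hT : 0 < T) :
    BoundedVariationOn (fun s : ℝ => max 0 (min s T)) Set.univ := by
  refine MonotoneOn.boundedVariationOn (C := T) ?_ fun s _ => ?_
  · intro s _ s' _ h
    dsimp only
    gcongr
  · rw [abs_of_nonneg (le_max_left _ _)]
    exact max_le hT.le (min_le_right _ _)

theorem boundedVariationOn_affinePath (hT : 0 < T) (a p w q : Vec n) :
    BoundedVariationOn (affinePath T a p w q) Set.univ := by
  -- A constant, a step of height `p - a` at `0`, a step of height `q - (p + T w)` at `T`, and a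
  -- clamped ramp of slope `w`.
  have h : affinePath T a p w q = fun s =>
      (((1 : ℝ) • a + (if s < 0 then (0 : ℝ) else 1) • (p - a)) +
        (if s < T then (0 : ℝ) else 1) • (q - p - T • w)) + (max 0 (min s T)) • w := by
    ext s i
    simp only [affinePath]
    rcases lt_or_ge s 0 with h0 | h0
    · have : s < T := h0.trans hT
      simp [h0, this, min_eq_left this.le, h0.le]
    · rcases lt_or_ge s T with h1 | h1
      · simp [h0.not_gt, h1, min_eq_left h1.le, max_eq_right h0]
      · simp [h0.not_gt, h1.not_gt, min_eq_right h1, max_eq_right hT.le]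
        ring
  have hc : BoundedVariationOn (fun _ : ℝ => (1 : ℝ)) Set.univ :=
    MonotoneOn.boundedVariationOn (C := 1) (fun _ _ _ _ _ => le_rfl) (by simp)
  rw [h]
  exact boundedVariationOn_add (boundedVariationOn_add (boundedVariationOn_add
    (boundedVariationOn_smul_const hc a)
    (boundedVariationOn_smul_const (boundedVariationOn_step 0) _))
    (boundedVariationOn_smul_const (boundedVariationOn_step T) _))
    (boundedVariationOn_smul_const (boundedVariationOn_clamp hT) w)

theorem pathFrom_eq_affinePath {Ω : Type*} (hT : 0 < T) (a p w q : Vec n)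
    {X : Time T → Ω → Vec n}
    (hX : ∀ s ω, X s ω = if (s : ℝ) < T then p + (s : ℝ) • w else q) (ω : Ω) :
    pathFrom hT a X ω = affinePath T a p w q := by
  ext1 s
  simp only [pathFrom, affinePath, path, Set.IccExtend, Function.comp_apply, hX]
  split_ifs with h0 h1 h2 h3
  · rfl
  · rw [Set.projIcc_of_mem hT.le ⟨not_lt.1 h0, h2.le⟩]
  · rw [Set.coe_projIcc, min_eq_left (not_lt.1 h2), max_eq_right hT.le] at h1
    exact absurd h1 (lt_irrefl _)
  · rw [Set.projIcc_of_mem hT.le ⟨not_lt.1 h0, h3.le⟩] at h1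
    exact absurd h3 h1
  · rfl

theorem isCadlagFV_of_affine {Ω : Type*} {mΩ : MeasurableSpace Ω} (hT : 0 < T)
    (𝓕 : Filtration (Time T) mΩ) (a p w q : Vec n) {X : Time T → Ω → Vec n}
    (hX : ∀ s ω, X s ω = if (s : ℝ) < T then p + (s : ℝ) • w else q) :
    IsCadlagFV hT 𝓕 a X where
  adapted t := by
    rw [show X t = fun _ => if (t : ℝ) < T then p + (t : ℝ) • w else q from funext (hX t)]
    exact measurable_const
  right_continuous ω s := by
    rw [pathFrom_eq_affinePath hT a p w q hX]
    exact continuousWithinAt_affinePath T a p w q s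
  finite_variation ω := by
    rw [pathFrom_eq_affinePath hT a p w q hX]
    exact boundedVariationOn_affinePath hT a p w q

theorem isStronglyProgressive_of_affine {Ω : Type*} {mΩ : MeasurableSpace Ω}
    (𝓕 : Filtration (Time T) mΩ) (p w q : Vec n) {X : Time T → Ω → Vec n}
    (hX : ∀ s ω, X s ω = if (s : ℝ) < T then p + (s : ℝ) • w else q) :
    IsStronglyProgressive 𝓕 X := by
  intro t
  have hm : Measurable fun s : ℝ => if s < T then p + s • w else q :=
    Measurable.ite measurableSet_Iio (by fun_prop) measurable_const
  have hs : Measurable fun s : Set.Iic t => if ((s : Time T) : ℝ) < T then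
      p + ((s : Time T) : ℝ) • w else q :=
    hm.comp (measurable_subtype_coe.comp measurable_subtype_coe)
  simp only [hX]
  exact (hs.comp (@measurable_fst _ _ _ (𝓕 t))).stronglyMeasurable

end Affine

/-! ### Interval integrals of vector-valued functions -/

section Calculus

variable {n : ℕ}

theorem intervalIntegral_mulVec (A : Mat n) {f : ℝ → Vec n} {a b : ℝ}
    (hf : IntervalIntegrable f volume a b) :
    ∫ s in a..b, A *ᵥ f s = A *ᵥ ∫ s in a..b, f s :=
  (LinearMap.toContinuousLinearMap (Matrix.mulVecLin A)).intervalIntegral_comp_comm hf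

theorem intervalIntegral_apply {f : ℝ → Vec n} {a b : ℝ}
    (hf : IntervalIntegrable f volume a b) (i : Fin n) :
    (∫ s in a..b, f s) i = ∫ s in a..b, f s i :=
  ((ContinuousLinearMap.proj (R := ℝ) (φ := fun _ : Fin n => ℝ) i).intervalIntegral_comp_comm
    hf).symm

theorem intervalIntegrable_apply {f : ℝ → Vec n} {a b : ℝ}
    (hf : IntervalIntegrable f volume a b) (i : Fin n) :
    IntervalIntegrable (fun s => f s i) volume a b :=
  ⟨hf.1.eval i, hf.2.eval i⟩

theorem intervalIntegrable_of_apply {f : ℝ → Vec n} {a b : ℝ}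
    (hf : ∀ i, IntervalIntegrable (fun s => f s i) volume a b) :
    IntervalIntegrable f volume a b :=
  ⟨Integrable.of_eval fun i => (hf i).1, Integrable.of_eval fun i => (hf i).2⟩

theorem intervalIntegrable_mulVec {A : ℝ → Mat n} (hA : Continuous A) {f : ℝ → Vec n} {a b : ℝ}
    (hf : IntervalIntegrable f volume a b) :
    IntervalIntegrable (fun s => A s *ᵥ f s) volume a b := by
  refine intervalIntegrable_of_apply fun i => ?_
  simp only [Matrix.mulVec, dotProduct]
  have : (fun s => ∑ j, A s i j * f s j) = ∑ j, fun s => A s i j * f s j := by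
    ext s; simp
  rw [this]
  refine IntervalIntegrable.sum _ fun j _ => ?_
  exact (intervalIntegrable_apply hf j).continuousOn_mul
    ((continuous_apply_apply i j).comp hA).continuousOn

/-- Integration by parts for a smooth function and the primitive of an integrable one. -/
theorem mul_sub_integral_eq {f f' φ : ℝ → ℝ} {a r : ℝ} (c : ℝ)
    (hf : ∀ s, HasDerivAt f (f' s) s) (hf' : Continuous f')
    (hφ : IntervalIntegrable φ volume a r) :
    f r * (c - ∫ s in a..r, φ s) =
      f a * c + ∫ s in a..r, (f' s * (c - ∫ u in a..s, φ u) - f s * φ s) := by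
  have hd : deriv f = f' := funext fun s => (hf s).deriv
  have hfc : ContDiff ℝ 1 f :=
    contDiff_one_iff_deriv.2 ⟨fun s => (hf s).differentiableAt, hd ▸ hf'⟩
  -- `φ` is only integrable, so its primitive is differentiable only almost everywhere; the product
  -- rule is therefore applied to absolutely continuous functions.
  have h1 : AbsolutelyContinuousOnInterval f a r :=
    hfc.contDiffOn.absolutelyContinuousOnInterval
  have h2 : AbsolutelyContinuousOnInterval (fun s => c - ∫ u in a..s, φ u) a r :=
    (contDiff_const (c := c) (n := 1)).contDiffOn.absolutelyContinuousOnInterval.sub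
      (hφ.absolutelyContinuousOnInterval_intervalIntegral (by simp))
  have h3 := h1.integral_deriv_mul_eq_sub h2
  have h4 : ∫ s in a..r, (f' s * (c - ∫ u in a..s, φ u) - f s * φ s) =
      ∫ s in a..r, deriv f s * (c - ∫ u in a..s, φ u) +
        f s * deriv (fun s => c - ∫ u in a..s, φ u) s := by
    refine intervalIntegral.integral_congr_ae ?_
    filter_upwards [hφ.ae_hasDerivAt_integral] with s hs hmem
    have := (hs (Set.uIoc_subset_uIcc hmem) a (by simp)).const_sub c
    rw [this.deriv, hd]
    ring
  rw [h4, h3]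
  simp

/-- The scalar formula is applied to each matrix entry. It serves with `N = ν⁻¹` for the equation of
a general deviation, and with `N = ν` for the explicit integral along the candidate. -/
theorem mulVec_sub_integral_eq {N N' : ℝ → Mat n} {φ : ℝ → Vec n} {a r : ℝ} (c : Vec n)
    (hN : ∀ s i j, HasDerivAt (fun t => N t i j) (N' s i j) s) (hN' : Continuous N')
    (hφ : IntervalIntegrable φ volume a r) :
    N r *ᵥ (c - ∫ s in a..r, φ s) =
      N a *ᵥ c + ∫ s in a..r, (N' s *ᵥ (c - ∫ u in a..s, φ u) - N s *ᵥ φ s) := by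
  have hNc : Continuous N := continuous_pi fun i => continuous_pi fun j =>
    continuous_iff_continuousAt.2 fun s => (hN s i j).continuousAt
  have hprim : ContinuousOn (fun s => ∫ u in a..s, φ u) (Set.uIcc a r) :=
    intervalIntegral.continuousOn_primitive_interval' hφ (by simp)
  have hΨ : ContinuousOn (fun s => c - ∫ u in a..s, φ u) (Set.uIcc a r) :=
    continuousOn_const.sub hprim
  have hint : IntervalIntegrable
      (fun s => N' s *ᵥ (c - ∫ u in a..s, φ u) - N s *ᵥ φ s) volume a r :=
    (intervalIntegrable_mulVec hN' hΨ.intervalIntegrable).sub (intervalIntegrable_mulVec hNc hφ)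
  have hcoord : ∀ s ∈ Set.uIcc a r, ∀ j, (∫ u in a..s, φ u) j = ∫ u in a..s, φ u j :=
    fun s hs j => intervalIntegral_apply
      (hφ.mono_set (Set.uIcc_subset_uIcc Set.left_mem_uIcc hs)) j
  have hentry : ∀ i j, Continuous fun s => N' s i j := fun i j =>
    (continuous_apply_apply i j).comp hN'
  ext i
  rw [Pi.add_apply, intervalIntegral_apply hint]
  have h1 : ∫ s in a..r, (N' s *ᵥ (c - ∫ u in a..s, φ u) - N s *ᵥ φ s) i =
      ∫ s in a..r, ∑ j, (N' s i j * (c j - ∫ u in a..s, φ u j) - N s i j * φ s j) := by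
    refine intervalIntegral.integral_congr fun s hs => ?_
    simp [Matrix.mulVec, dotProduct, hcoord s hs, Finset.sum_sub_distrib]
  rw [h1, intervalIntegral.integral_finsetSum]
  · simp only [Matrix.mulVec, dotProduct, Pi.sub_apply, hcoord r Set.right_mem_uIcc]
    rw [← Finset.sum_add_distrib]
    exact Finset.sum_congr rfl fun j _ => mul_sub_integral_eq (c j) (fun s => hN s i j)
      (hentry i j) (intervalIntegrable_apply hφ j)
  · intro j _
    refine IntervalIntegrable.sub ?_ ?_
    · refine IntervalIntegrable.continuousOn_mul ?_ (hentry i j).continuousOn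
      refine ContinuousOn.intervalIntegrable ?_
      refine continuousOn_const.sub ?_
      exact intervalIntegral.continuousOn_primitive_interval' (intervalIntegrable_apply hφ j)
        (by simp)
    · exact (intervalIntegrable_apply hφ j).continuousOn_mul
        ((continuous_apply_apply i j).comp hNc).continuousOn

end Calculus

/-! ### The deviation along a path -/

section Deviation

variable {n : ℕ} {O : Mat n} {lam : Vec n} {ρ : Mat n} {T : ℝ}

/-- The deviation associated to a deterministic path `f`. -/
noncomputable def pathDeviation (O : Mat n) (lam : Vec n) (ρ : Mat n) (x d : Vec n)
    (f : ℝ → Vec n) (r : ℝ) : Vec n :=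
  impact O lam *ᵥ f r + (nu ρ r)⁻¹ *ᵥ
    (d - impact O lam *ᵥ x - ∫ s in (0 : ℝ)..r, (nu ρ s * ρ * impact O lam) *ᵥ f s)

theorem path_coe {Ω : Type*} (hT : 0 < T) (X : Time T → Ω → Vec n) (ω : Ω) (r : Time T) :
    path hT X ω r = X r ω := by
  simp [path, Set.IccExtend]

theorem path_of_mem {Ω : Type*} (hT : 0 < T) (X : Time T → Ω → Vec n) (ω : Ω) {s : ℝ}
    (hs : s ∈ Set.Icc 0 T) : path hT X ω s = X ⟨s, hs⟩ ω :=
  path_coe hT X ω ⟨s, hs⟩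

theorem deviation_eq_pathDeviation {Ω : Type*} (hT : 0 < T) (x d : Vec n)
    (X : Time T → Ω → Vec n) (r : Time T) (ω : Ω) :
    deviation hT O lam ρ x d X r ω = pathDeviation O lam ρ x d (path hT X ω) r := by
  rw [deviation, pathDeviation, path_coe]

theorem path_deviation {Ω : Type*} (hT : 0 < T) (x d : Vec n)
    (X : Time T → Ω → Vec n) (ω : Ω) {s : ℝ} (hs : s ∈ Set.Icc 0 T) :
    path hT (deviation hT O lam ρ x d X) ω s = pathDeviation O lam ρ x d (path hT X ω) s := by
  rw [path_of_mem hT _ ω hs, deviation_eq_pathDeviation]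

theorem continuous_nu_mul (ρ A : Mat n) : Continuous fun s => nu ρ s * ρ * A :=
  ((continuous_nu ρ).mul continuous_const).mul continuous_const

theorem intervalIntegrable_pathDeviation (x d : Vec n) {f : ℝ → Vec n}
    (hf : IntervalIntegrable f volume 0 T) :
    IntervalIntegrable (pathDeviation O lam ρ x d f) volume 0 T := by
  refine (intervalIntegrable_mulVec continuous_const hf).add ?_
  simp only [inv_nu]
  refine intervalIntegrable_mulVec ((continuous_nu ρ).comp continuous_neg) ?_
  refine ContinuousOn.intervalIntegrable (continuousOn_const.sub ?_)
  exact intervalIntegral.continuousOn_primitive_interval'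
    (intervalIntegrable_mulVec (continuous_nu_mul ρ _) hf) (by simp)

/-- The deviation solves the integrated equation `dD = -ρ D ds + γ dX`. -/
theorem pathDeviation_eq (x d : Vec n) {f : ℝ → Vec n}
    (hf : IntervalIntegrable f volume 0 T) {r : ℝ} (hr : r ∈ Set.Icc 0 T) :
    pathDeviation O lam ρ x d f r = impact O lam *ᵥ f r + (d - impact O lam *ᵥ x) -
      ∫ s in (0 : ℝ)..r, ρ *ᵥ pathDeviation O lam ρ x d f s := by
  have hsub : Set.uIcc 0 r ⊆ Set.uIcc 0 T :=
    Set.uIcc_subset_uIcc Set.left_mem_uIcc (Set.Icc_subset_uIcc hr)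
  have hφ : IntervalIntegrable (fun s => (nu ρ s * ρ * impact O lam) *ᵥ f s) volume 0 r :=
    intervalIntegrable_mulVec (continuous_nu_mul ρ _) (hf.mono_set hsub)
  have hN : ∀ s i j, HasDerivAt (fun t => nu ρ (-t) i j) ((-(nu ρ (-s) * ρ)) i j) s := by
    intro s i j
    have := (hasDerivAt_nu_apply ρ (-s) i j).comp s (hasDerivAt_neg s)
    simpa [Function.comp_def] using this
  have hN' : Continuous fun s => -(nu ρ (-s) * ρ) :=
    (((continuous_nu ρ).comp continuous_neg).mul continuous_const).neg
  -- Here `(ν⁻¹)' = -ν⁻¹ ρ`, and `ν⁻¹` cancels the `ν` in the integrand `ν ρ γ f`. The two resulting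
  -- terms combine to `-ρ` times the deviation.
  have key := mulVec_sub_integral_eq (N := fun s => nu ρ (-s)) (d - impact O lam *ᵥ x) hN hN' hφ
  rw [pathDeviation, inv_nu, key]
  simp only [neg_zero, nu_zero, Matrix.one_mulVec]
  rw [add_sub_assoc, sub_eq_add_neg _ (∫ s in (0 : ℝ)..r, _), ← intervalIntegral.integral_neg]
  congr 2
  refine intervalIntegral.integral_congr fun s _ => ?_
  have hc : Commute (nu ρ (-s)) ρ := commute_nu (Commute.refl ρ) _
  simp only [pathDeviation, inv_nu]
  rw [Matrix.mulVec_add, Matrix.mulVec_mulVec, Matrix.mulVec_mulVec, Matrix.mulVec_mulVec,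
    Matrix.neg_mulVec, hc.eq, ← Matrix.mul_assoc, ← Matrix.mul_assoc, nu_neg_mul_nu,
    Matrix.one_mul]
  abel

end Deviation

/-! ### The candidate strategy -/

section Candidate

variable {n : ℕ} {O : Mat n} {lam : Vec n} {ρ : Mat n} {T : ℝ}

/-- The vector `(2 I + T ρ)⁻¹ (x - γ⁻¹ d)`. -/
noncomputable def optimalVector (T : ℝ) (O : Mat n) (lam : Vec n) (ρ : Mat n) (x d : Vec n) :
    Vec n :=
  ((2 : ℝ) • (1 : Mat n) + T • ρ)⁻¹ *ᵥ (x - impactPow O lam (-1) *ᵥ d)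

/-- The deterministic strategy `s ↦ (I + (T - s) ρ) (2 I + T ρ)⁻¹ (x - γ⁻¹ d)` on `[0, T)`,
closing the position at time `T`. -/
noncomputable def optimalStrategy (Ω : Type*) (O : Mat n) (lam : Vec n) (ρ : Mat n)
    (x d : Vec n) (s : Time T) (_ : Ω) : Vec n :=
  if (s : ℝ) < T then (1 + (T - (s : ℝ)) • ρ) *ᵥ optimalVector T O lam ρ x d else 0

variable {Ω : Type*}

theorem optimalStrategy_eq_affine (x d : Vec n) (s : Time T) (ω : Ω) :
    optimalStrategy Ω O lam ρ x d s ω =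
      if (s : ℝ) < T then (optimalVector T O lam ρ x d + T • ρ *ᵥ optimalVector T O lam ρ x d) +
        (s : ℝ) • (-(ρ *ᵥ optimalVector T O lam ρ x d)) else 0 := by
  rw [optimalStrategy]
  congr 1
  rw [Matrix.add_mulVec, Matrix.one_mulVec, Matrix.smul_mulVec, sub_smul]
  module

/-- The linear system defining the optimal vector, multiplied by `γ` so that its right-hand side is
the negative of the constant `d - γ x` in the deviation. -/
theorem two_smul_optimalVector (hO : O ∈ Matrix.orthogonalGroup (Fin n) ℝ)
    (hlam : ∀ j, 0 < lam j) (hρ : ρ.PosDef) (hT : 0 < T) (x d : Vec n) :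
    impact O lam *ᵥ ((2 : ℝ) • optimalVector T O lam ρ x d +
      T • ρ *ᵥ optimalVector T O lam ρ x d) = impact O lam *ᵥ x - d := by
  have h : (2 : ℝ) • optimalVector T O lam ρ x d + T • ρ *ᵥ optimalVector T O lam ρ x d =
      x - impactPow O lam (-1) *ᵥ d := by
    have : (2 : ℝ) • optimalVector T O lam ρ x d + T • ρ *ᵥ optimalVector T O lam ρ x d =
        ((2 : ℝ) • (1 : Mat n) + T • ρ) *ᵥ optimalVector T O lam ρ x d := by
      simp [Matrix.add_mulVec, Matrix.smul_mulVec]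
    rw [this, optimalVector, Matrix.mulVec_mulVec,
      Matrix.mul_nonsing_inv _ (isUnit_det_two_add_smul hρ hT), Matrix.one_mulVec]
  rw [h, Matrix.mulVec_sub, Matrix.mulVec_mulVec, ← impactPow_one, impactPow_mul hO hlam,
    add_neg_cancel, impactPow_zero hO, Matrix.one_mulVec]

theorem neg_impact_mulVec_optimalVector (hO : O ∈ Matrix.orthogonalGroup (Fin n) ℝ)
    (hlam : ∀ j, 0 < lam j) (hρ : ρ.PosDef) (hcomm : ρ * impact O lam = impact O lam * ρ)
    (hT : 0 < T) (x d : Vec n) :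
    -(impact O lam *ᵥ optimalVector T O lam ρ x d) =
      impactPow O lam (1 / 2) *ᵥ (((2 : ℝ) • (1 : Mat n) + T • ρ)⁻¹ *ᵥ
        (impactPow O lam (-(1 / 2)) *ᵥ d - impactPow O lam (1 / 2) *ᵥ x)) := by
  set M : Mat n := (2 : ℝ) • (1 : Mat n) + T • ρ with hM
  have hu : IsUnit M.det := isUnit_det_two_add_smul hρ hT
  have hc : ∀ α, impactPow O lam α * M⁻¹ = M⁻¹ * impactPow O lam α := by
    intro α
    have h : impactPow O lam α * M = M * impactPow O lam α := by
      have := (commute_impactPow hO hcomm α).eq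
      simp [hM, Matrix.mul_add, Matrix.add_mul, this]
    calc impactPow O lam α * M⁻¹ = M⁻¹ * (M * impactPow O lam α) * M⁻¹ := by
          rw [← Matrix.mul_assoc, Matrix.nonsing_inv_mul _ hu, Matrix.one_mul]
      _ = M⁻¹ * impactPow O lam α * (M * M⁻¹) := by
          rw [← h]; simp only [Matrix.mul_assoc]
      _ = _ := by rw [Matrix.mul_nonsing_inv _ hu, Matrix.mul_one]
  rw [optimalVector, ← hM, ← impactPow_one, Matrix.mulVec_mulVec, Matrix.mulVec_mulVec, hc, hc,
    Matrix.mulVec_sub, Matrix.mulVec_sub, Matrix.mulVec_mulVec, Matrix.mulVec_mulVec,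
    Matrix.mulVec_mulVec, Matrix.mul_assoc, Matrix.mul_assoc, Matrix.mul_assoc,
    impactPow_mul hO hlam, impactPow_mul hO hlam, impactPow_mul hO hlam]
  norm_num

theorem path_optimalStrategy (hT : 0 < T) (x d : Vec n) (ω : Ω) {s : ℝ}
    (hs : s ∈ Set.Ico 0 T) :
    path hT (optimalStrategy Ω O lam ρ x d) ω s =
      optimalVector T O lam ρ x d + (T - s) • ρ *ᵥ optimalVector T O lam ρ x d := by
  rw [path_of_mem hT _ ω ⟨hs.1, hs.2.le⟩, optimalStrategy, if_pos hs.2]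
  simp [Matrix.add_mulVec, Matrix.smul_mulVec]

/-- The candidate and its deviation may jump at `T`, so their formulas on `[0, T)` enter integrals
over `[0, T]` only almost everywhere. -/
theorem ae_ne_endpoint (T : ℝ) : ∀ᵐ s : ℝ, s ≠ T := by
  simp [ae_iff, measure_singleton]

theorem intervalIntegrable_path_optimalStrategy (hT : 0 < T) (x d : Vec n) (ω : Ω) :
    IntervalIntegrable (path hT (optimalStrategy Ω O lam ρ x d) ω) volume 0 T := by
  have hc : Continuous fun s : ℝ => optimalVector T O lam ρ x d +
      (T - s) • ρ *ᵥ optimalVector T O lam ρ x d := by fun_prop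
  refine (hc.intervalIntegrable 0 T).congr_ae ?_
  rw [Set.uIoc_of_le hT.le]
  filter_upwards [ae_restrict_mem measurableSet_Ioc, ae_restrict_of_ae (ae_ne_endpoint T)]
    with s hs hne
  exact (path_optimalStrategy hT x d ω ⟨hs.1.le, lt_of_le_of_ne hs.2 hne⟩).symm

/-- With `e` the optimal vector, the integrand agrees almost everywhere with the derivative of `ν(s)
γ (2 e + (T - s) ρ e)`: differentiating `ν` gives `ν ρ γ (2 e + (T - s) ρ e)`, and differentiating
the affine factor removes one `ν ρ γ e`. At `s = 0` the primitive equals `γ x - d`. -/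
theorem integral_nu_mulVec_optimalStrategy (hO : O ∈ Matrix.orthogonalGroup (Fin n) ℝ)
    (hlam : ∀ j, 0 < lam j) (hρ : ρ.PosDef) (hcomm : ρ * impact O lam = impact O lam * ρ)
    (hT : 0 < T) (x d : Vec n) (ω : Ω) {r : ℝ} (hr : r ∈ Set.Icc 0 T) :
    ∫ s in (0 : ℝ)..r, (nu ρ s * ρ * impact O lam) *ᵥ
        path hT (optimalStrategy Ω O lam ρ x d) ω s =
      nu ρ r *ᵥ (impact O lam *ᵥ ((2 : ℝ) • optimalVector T O lam ρ x d +
        (T - r) • ρ *ᵥ optimalVector T O lam ρ x d)) - (impact O lam *ᵥ x - d) := by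
  set e := optimalVector T O lam ρ x d with he
  have hN' : Continuous fun s => nu ρ s * ρ := (continuous_nu ρ).mul continuous_const
  have key := mulVec_sub_integral_eq (N := nu ρ) (a := 0) (r := r)
    (φ := fun _ => impact O lam *ᵥ (ρ *ᵥ e)) (impact O lam *ᵥ x - d)
    (hasDerivAt_nu_apply ρ) hN' intervalIntegrable_const
  simp only [intervalIntegral.integral_const, sub_zero, nu_zero, Matrix.one_mulVec] at key
  rw [← two_smul_optimalVector hO hlam hρ hT x d, ← he] at key ⊢
  have hlin : ∀ s : ℝ, impact O lam *ᵥ ((2 : ℝ) • e + T • ρ *ᵥ e) -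
      s • impact O lam *ᵥ (ρ *ᵥ e) =
      impact O lam *ᵥ ((2 : ℝ) • e + (T - s) • ρ *ᵥ e) := by
    intro s
    rw [← Matrix.mulVec_smul (impact O lam), ← Matrix.mulVec_sub]
    congr 1
    module
  simp only [hlin] at key
  rw [key, add_sub_cancel_left]
  refine intervalIntegral.integral_congr_ae ?_
  filter_upwards [ae_ne_endpoint T] with s hne hs
  rw [Set.uIoc_of_le hr.1] at hs
  rw [path_optimalStrategy hT x d ω ⟨hs.1.le, lt_of_le_of_ne (hs.2.trans hr.2) hne⟩, ← he]
  have h : nu ρ s *ᵥ (impact O lam *ᵥ (ρ *ᵥ e)) = (nu ρ s * ρ * impact O lam) *ᵥ e := by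
    simp only [Matrix.mulVec_mulVec, Matrix.mul_assoc, hcomm]
  rw [h, Matrix.mulVec_mulVec _ (nu ρ s * ρ), ← Matrix.mulVec_sub]
  congr 1
  module

/-- The boundary term `γ x - d` of the integral cancels `d - γ x`. With `e` the optimal vector, what
remains is `γ X(s) - γ (2 e + (T - s) ρ e)`: it equals `-γ e` before `T`, and `-2 γ e` at `T`, where
the position is closed. -/
theorem deviation_optimalStrategy (hO : O ∈ Matrix.orthogonalGroup (Fin n) ℝ)
    (hlam : ∀ j, 0 < lam j) (hρ : ρ.PosDef) (hcomm : ρ * impact O lam = impact O lam * ρ)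
    (hT : 0 < T) (x d : Vec n) (s : Time T) (ω : Ω) :
    deviation hT O lam ρ x d (optimalStrategy Ω O lam ρ x d) s ω =
      if (s : ℝ) < T then -(impact O lam *ᵥ optimalVector T O lam ρ x d)
      else (2 : ℝ) • -(impact O lam *ᵥ optimalVector T O lam ρ x d) := by
  rw [deviation, integral_nu_mulVec_optimalStrategy hO hlam hρ hcomm hT x d ω s.2, inv_nu,
    Matrix.mulVec_sub, Matrix.mulVec_sub, Matrix.mulVec_sub, Matrix.mulVec_sub,
    Matrix.mulVec_mulVec _ (nu ρ (-s)) (nu ρ s), nu_neg_mul_nu, Matrix.one_mulVec]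
  set e := optimalVector T O lam ρ x d with he
  rcases lt_or_ge (s : ℝ) T with h | h
  · rw [if_pos h, optimalStrategy, if_pos h, ← he, Matrix.add_mulVec, Matrix.smul_mulVec,
      Matrix.one_mulVec, Matrix.mulVec_add, Matrix.mulVec_add, Matrix.mulVec_smul _ (2 : ℝ)]
    module
  · have : (s : ℝ) = T := le_antisymm s.2.2 h
    rw [if_neg h.not_gt, optimalStrategy, if_neg h.not_gt, this, sub_self, zero_smul, add_zero,
      Matrix.mulVec_smul, Matrix.mulVec_zero]
    module

/-- The Stieltjes integral of the constant `γ` over `[0, r]` is `γ (X(r) - x)`, the initial jump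
included, so the equation is `pathDeviation_eq` rearranged. -/
theorem isDeviationFV_optimalStrategy {mΩ : MeasurableSpace Ω}
    (hO : O ∈ Matrix.orthogonalGroup (Fin n) ℝ)
    (hlam : ∀ j, 0 < lam j) (hρ : ρ.PosDef) (hcomm : ρ * impact O lam = impact O lam * ρ)
    (hT : 0 < T) (𝓕 : Filtration (Time T) mΩ) (x d : Vec n) :
    IsDeviationFV hT 𝓕 O lam ρ x d (optimalStrategy Ω O lam ρ x d)
      (deviation hT O lam ρ x d (optimalStrategy Ω O lam ρ x d)) := by
  refine ⟨isCadlagFV_of_affine hT 𝓕 d _ 0 _ fun s ω => by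
    simpa using deviation_optimalStrategy hO hlam hρ hcomm hT x d s ω, fun ω r => ?_⟩
  have hfrom := pathFrom_eq_affinePath hT x _ _ _
    (optimalStrategy_eq_affine (O := O) (lam := lam) (ρ := ρ) (T := T) (Ω := Ω) x d) ω
  have hr : pathFrom hT x (optimalStrategy Ω O lam ρ x d) ω r =
      path hT (optimalStrategy Ω O lam ρ x d) ω r := by
    rw [pathFrom, if_neg r.2.1.not_gt]
  have hint : ∫ s in (0 : ℝ)..r, ρ *ᵥ path hT (deviation hT O lam ρ x d
      (optimalStrategy Ω O lam ρ x d)) ω s = ∫ s in (0 : ℝ)..r, ρ *ᵥ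
        pathDeviation O lam ρ x d (path hT (optimalStrategy Ω O lam ρ x d) ω) s := by
    refine intervalIntegral.integral_congr fun s hs => ?_
    rw [Set.uIcc_of_le r.2.1] at hs
    simp only [path_deviation hT x d _ ω ⟨hs.1, hs.2.trans r.2.2⟩]
  rw [stieltjesIntegral_const_Icc (y := x) _ r.2.1, hr, hint, deviation_eq_pathDeviation,
    pathDeviation_eq x d (intervalIntegrable_path_optimalStrategy hT x d ω) r.2,
    Matrix.mulVec_sub]
  · abel
  · rw [hfrom]; exact boundedVariationOn_affinePath hT _ _ _ _
  · rw [hfrom]; exact continuousWithinAt_affinePath T _ _ _ _ _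
  · rw [hfrom]; exact tendsto_affinePath_zero_left T _ _ _ _

theorem squareIntegrableDeviation_optimalStrategy {mΩ : MeasurableSpace Ω} (P : Measure Ω)
    [IsProbabilityMeasure P] (hO : O ∈ Matrix.orthogonalGroup (Fin n) ℝ)
    (hlam : ∀ j, 0 < lam j) (hρ : ρ.PosDef) (hcomm : ρ * impact O lam = impact O lam * ρ)
    (hT : 0 < T) (x d : Vec n) :
    SquareIntegrableDeviation P hT O lam
      (deviation hT O lam ρ x d (optimalStrategy Ω O lam ρ x d)) := by
  set v := impactPow O lam (-(1 / 2)) *ᵥ (-(impact O lam *ᵥ optimalVector T O lam ρ x d)) with hv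
  have h : ∀ ω, ∫⁻ s in Set.Icc (0 : ℝ) T, ENNReal.ofReal
      ((impactPow O lam (-(1 / 2)) *ᵥ path hT (deviation hT O lam ρ x d
        (optimalStrategy Ω O lam ρ x d)) ω s) ⬝ᵥ (impactPow O lam (-(1 / 2)) *ᵥ path hT
          (deviation hT O lam ρ x d (optimalStrategy Ω O lam ρ x d)) ω s)) =
      ENNReal.ofReal (v ⬝ᵥ v) * ENNReal.ofReal T := by
    intro ω
    have hconst : ENNReal.ofReal (v ⬝ᵥ v) * ENNReal.ofReal T =
        ∫⁻ _ in Set.Icc (0 : ℝ) T, ENNReal.ofReal (v ⬝ᵥ v) := by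
      rw [setLIntegral_const, Real.volume_Icc, sub_zero]
    rw [hconst]
    refine lintegral_congr_ae ?_
    filter_upwards [ae_restrict_mem measurableSet_Icc, ae_restrict_of_ae (ae_ne_endpoint T)]
      with s hs hne
    rw [path_of_mem hT _ ω hs, deviation_optimalStrategy hO hlam hρ hcomm,
      if_pos (lt_of_le_of_ne hs.2 hne), ← hv]
  rw [SquareIntegrableDeviation]
  simp only [h]
  simp [ENNReal.mul_lt_top]

theorem isPMStrategy_optimalStrategy {mΩ : MeasurableSpace Ω} (P : Measure Ω)
    [IsProbabilityMeasure P] (hO : O ∈ Matrix.orthogonalGroup (Fin n) ℝ)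
    (hlam : ∀ j, 0 < lam j) (hρ : ρ.PosDef) (hcomm : ρ * impact O lam = impact O lam * ρ)
    (hT : 0 < T) (𝓕 : Filtration (Time T) mΩ) (x d : Vec n) :
    IsPMStrategy P hT 𝓕 O lam ρ x d (optimalStrategy Ω O lam ρ x d) where
  progressive := isStronglyProgressive_of_affine 𝓕 _ _ _ (optimalStrategy_eq_affine x d)
  square_integrable := by
    refine ae_of_all _ fun ω => ?_
    have hc : Continuous fun s : ℝ => (optimalVector T O lam ρ x d +
      (T - s) • ρ *ᵥ optimalVector T O lam ρ x d) ⬝ᵥ (optimalVector T O lam ρ x d +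
      (T - s) • ρ *ᵥ optimalVector T O lam ρ x d) := by
      simp only [dotProduct]
      fun_prop
    have hi := (hc.integrableOn_Icc (μ := volume) (a := 0) (b := T)).lintegral_lt_top
    refine lt_of_eq_of_lt (lintegral_congr_ae ?_) hi
    filter_upwards [ae_restrict_mem measurableSet_Icc, ae_restrict_of_ae (ae_ne_endpoint T)]
      with s hs hne
    rw [path_optimalStrategy hT x d ω ⟨hs.1, lt_of_le_of_ne hs.2 hne⟩]
  terminal := ae_of_all _ fun ω => by simp [optimalStrategy, endTime]
  deviation_integrable := squareIntegrableDeviation_optimalStrategy P hO hlam hρ hcomm hT x d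

theorem isFVStrategy_optimalStrategy {mΩ : MeasurableSpace Ω} (P : Measure Ω)
    [IsProbabilityMeasure P] (hO : O ∈ Matrix.orthogonalGroup (Fin n) ℝ)
    (hlam : ∀ j, 0 < lam j) (hρ : ρ.PosDef) (hcomm : ρ * impact O lam = impact O lam * ρ)
    (hT : 0 < T) (𝓕 : Filtration (Time T) mΩ) (x d : Vec n) :
    IsFVStrategy P hT 𝓕 O lam ρ x d (optimalStrategy Ω O lam ρ x d) where
  cadlagFV := isCadlagFV_of_affine hT 𝓕 x _ _ _ (optimalStrategy_eq_affine x d)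
  terminal ω := by simp [optimalStrategy, endTime]
  deviation_integrable := ⟨_, isDeviationFV_optimalStrategy hO hlam hρ hcomm hT 𝓕 x d,
    squareIntegrableDeviation_optimalStrategy P hO hlam hρ hcomm hT x d⟩

end Candidate

/-! ### Joint measurability -/

section Measurability

variable {n : ℕ} {O : Mat n} {lam : Vec n} {ρ : Mat n} {T : ℝ} {Ω : Type*}
  {mΩ : MeasurableSpace Ω}

/-- Progressive measurability at time `T` is joint measurability on all of `[0, T] × Ω`; projecting
onto the interval extends it to real times. -/
theorem measurable_path {𝓕 : Filtration (Time T) mΩ} (hT : 0 < T) {X : Time T → Ω → Vec n}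
    (hX : IsStronglyProgressive 𝓕 X) : Measurable fun p : Ω × ℝ => path hT X p.1 p.2 := by
  have h1 : Measurable[Subtype.instMeasurableSpace.prod (𝓕 (endTime hT))]
      fun p : Set.Iic (endTime hT) × Ω => X p.1 p.2 := (hX (endTime hT)).measurable
  have h2 : Measurable fun p : Set.Iic (endTime hT) × Ω => X p.1 p.2 :=
    h1.mono (sup_le_sup le_rfl (MeasurableSpace.comap_mono (𝓕.le _))) le_rfl
  have h3 : Measurable fun p : Ω × ℝ =>
      ((⟨Set.projIcc 0 T hT.le p.2, (Set.projIcc 0 T hT.le p.2).2.2⟩, p.1) :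
        Set.Iic (endTime hT) × Ω) :=
    ((continuous_projIcc.measurable.comp measurable_snd).subtype_mk).prodMk measurable_fst
  exact h2.comp h3

theorem measurable_mulVec {α : Type*} {mα : MeasurableSpace α} {A : α → Mat n} {f : α → Vec n}
    (hA : ∀ i j, Measurable fun a => A a i j) (hf : Measurable f) :
    Measurable fun a => A a *ᵥ f a := by
  refine measurable_pi_iff.2 fun i => ?_
  simp only [Matrix.mulVec, dotProduct]
  exact Finset.measurable_sum _ fun j _ =>
    (hA i j).mul ((measurable_pi_apply j).comp hf)

theorem measurable_dotProduct {α : Type*} {mα : MeasurableSpace α} {f g : α → Vec n}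
    (hf : Measurable f) (hg : Measurable g) : Measurable fun a => f a ⬝ᵥ g a := by
  simp only [dotProduct]
  exact Finset.measurable_sum _ fun j _ =>
    ((measurable_pi_apply j).comp hf).mul ((measurable_pi_apply j).comp hg)

theorem measurable_apply_apply_of_continuous {A : ℝ → Mat n} (hA : Continuous A) (i j : Fin n) :
    Measurable fun s => A s i j :=
  ((continuous_apply_apply i j).comp hA).measurable

theorem measurable_path_deviation {𝓕 : Filtration (Time T) mΩ} (hT : 0 < T) (x d : Vec n)
    {X : Time T → Ω → Vec n} (hX : IsStronglyProgressive 𝓕 X) :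
    Measurable fun p : Ω × ℝ => path hT (deviation hT O lam ρ x d X) p.1 p.2 := by
  have hpath := measurable_path hT hX
  have hproj : Measurable fun p : Ω × ℝ => ((Set.projIcc 0 T hT.le p.2 : Time T) : ℝ) :=
    (continuous_subtype_val.comp continuous_projIcc).measurable.comp measurable_snd
  have hφ : Measurable fun q : (Ω × ℝ) × ℝ =>
      (nu ρ q.2 * ρ * impact O lam) *ᵥ path hT X q.1.1 q.2 :=
    measurable_mulVec (fun i j => (measurable_apply_apply_of_continuous
      (continuous_nu_mul ρ _) i j).comp measurable_snd)
      (hpath.comp ((measurable_fst.comp measurable_fst).prodMk measurable_snd))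
  -- Encoding the variable upper limit as an indicator turns the primitive into a parametric
  -- integral over the whole line, to which measurability of partial integrals applies.
  have hset : MeasurableSet {q : (Ω × ℝ) × ℝ |
      0 < q.2 ∧ q.2 ≤ ((Set.projIcc 0 T hT.le q.1.2 : Time T) : ℝ)} :=
    (measurableSet_lt measurable_const measurable_snd).inter
      (measurableSet_le measurable_snd (hproj.comp measurable_fst))
  have hint : Measurable fun p : Ω × ℝ => ∫ s in (0 : ℝ)..(Set.projIcc 0 T hT.le p.2 : Time T),
      (nu ρ s * ρ * impact O lam) *ᵥ path hT X p.1 s := by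
    have h := ((hφ.indicator hset).stronglyMeasurable.integral_prod_right'
      (ν := (volume : Measure ℝ))).measurable
    convert h using 2 with p
    rw [intervalIntegral.integral_of_le (Set.projIcc 0 T hT.le p.2).2.1,
      ← integral_indicator measurableSet_Ioc]
    rfl
  have hN : ∀ i j, Measurable fun p : Ω × ℝ =>
      (nu ρ (Set.projIcc 0 T hT.le p.2 : Time T))⁻¹ i j := by
    intro i j
    simp only [inv_nu]
    exact (measurable_apply_apply_of_continuous
      ((continuous_nu ρ).comp continuous_neg) i j).comp hproj
  exact (measurable_mulVec (A := fun _ => impact O lam) (fun _ _ => measurable_const) hpath).add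
    (measurable_mulVec hN ((measurable_const (a := d - impact O lam *ᵥ x)).sub hint))

end Measurability

/-! ### Square-integrability -/

section SquareIntegrable

/-- Cauchy–Schwarz against the constant `1`, obtained by expanding `0 ≤ ∫ (t f - I)²` with `t` the
total mass and `I = ∫ f`; the case `t = 0` is separate because the expansion is divided by `t`. -/
theorem sq_integral_le {α : Type*} {mα : MeasurableSpace α} {μ : Measure α} [IsFiniteMeasure μ]
    {f : α → ℝ} (hf : Integrable f μ) (hf2 : Integrable (fun a => f a ^ 2) μ) :
    (∫ a, f a ∂μ) ^ 2 ≤ μ.real Set.univ * ∫ a, f a ^ 2 ∂μ := by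
  set I := ∫ a, f a ∂μ
  set t := μ.real Set.univ
  have ht : 0 ≤ t := measureReal_nonneg
  have h : 0 ≤ ∫ a, (t * f a - I) ^ 2 ∂μ := integral_nonneg fun a => sq_nonneg _
  have h2 : ∫ a, (t * f a - I) ^ 2 ∂μ = t * (t * ∫ a, f a ^ 2 ∂μ - I ^ 2) := by
    have : ∀ a, (t * f a - I) ^ 2 = t ^ 2 * f a ^ 2 - 2 * t * I * f a + I ^ 2 := fun a => by ring
    simp only [this]
    rw [integral_add (by exact (hf2.const_mul _).sub (hf.const_mul _)) (integrable_const _),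
      integral_sub (hf2.const_mul _) (hf.const_mul _), integral_const_mul, integral_const_mul,
      integral_const, smul_eq_mul]
    ring
  rw [h2] at h
  rcases ht.eq_or_lt with h0 | h0
  · have : μ = 0 := by
      rw [← Measure.measure_univ_eq_zero]
      exact (measureReal_eq_zero_iff).1 h0.symm
    simp [I, this]
  · nlinarith [(mul_nonneg_iff_of_pos_left h0).1 h]

theorem memLp_two_integral_prod {α β : Type*} {mα : MeasurableSpace α} {mβ : MeasurableSpace β}
    {μ : Measure α} {ν : Measure β} [IsFiniteMeasure μ] [IsFiniteMeasure ν] {f : α × β → ℝ}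
    (hf : MemLp f 2 (μ.prod ν)) : MemLp (fun a => ∫ b, f (a, b) ∂ν) 2 μ := by
  have h1 : Integrable f (μ.prod ν) := hf.integrable one_le_two
  have h2 : Integrable (fun p => f p ^ 2) (μ.prod ν) := hf.integrable_sq
  refine (memLp_two_iff_integrable_sq h1.integral_prod_left.aestronglyMeasurable).2 ?_
  refine (h2.integral_prod_left.const_mul (ν.real Set.univ)).mono'
    (h1.integral_prod_left.aestronglyMeasurable.pow 2) ?_
  filter_upwards [h1.prod_right_ae, h2.prod_right_ae] with a ha ha2
  rw [Real.norm_of_nonneg (sq_nonneg _)]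
  exact sq_integral_le ha ha2

end SquareIntegrable

/-! ### The quadratic identity -/

section Quadratic

variable {n : ℕ} {ρ : Mat n} {T : ℝ}

/-- The excess cost of a scaled deviation path `z` over the constant path `c`. -/
noncomputable def excess (T : ℝ) (ρ : Mat n) (c : Vec n) (z : ℝ → Vec n) : ℝ :=
  (1 / 2) * ((ρ *ᵥ ((∫ s in (0 : ℝ)..T, z s) - T • c)) ⬝ᵥ
    (ρ *ᵥ ((∫ s in (0 : ℝ)..T, z s) - T • c))) +
    ∫ s in (0 : ℝ)..T, (z s - c) ⬝ᵥ (ρ *ᵥ (z s - c))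

theorem dotProduct_mulVec_symm (hsymm : ρᵀ = ρ) (v w : Vec n) :
    v ⬝ᵥ (ρ *ᵥ w) = w ⬝ᵥ (ρ *ᵥ v) := by
  rw [Matrix.dotProduct_mulVec, ← Matrix.mulVec_transpose, hsymm, dotProduct_comm]

theorem intervalIntegrable_dotProduct_mulVec (A : Mat n) {z w : ℝ → Vec n} {a b : ℝ}
    (h : ∀ i j, IntervalIntegrable (fun s => z s i * w s j) volume a b) :
    IntervalIntegrable (fun s => z s ⬝ᵥ (A *ᵥ w s)) volume a b := by
  have : (fun s => z s ⬝ᵥ (A *ᵥ w s)) = ∑ i, ∑ j, fun s => A i j * (z s i * w s j) := by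
    ext s
    simp only [dotProduct, Matrix.mulVec, Finset.sum_apply, Finset.mul_sum]
    exact Finset.sum_congr rfl fun i _ => Finset.sum_congr rfl fun j _ => by ring
  rw [this]
  exact IntervalIntegrable.sum _ fun i _ => IntervalIntegrable.sum _ fun j _ =>
    (h i j).const_mul _

theorem intervalIntegrable_sub_dotProduct (c : Vec n) {z : ℝ → Vec n} {a b : ℝ}
    (hz : IntervalIntegrable z volume a b)
    (hz2 : ∀ i j, IntervalIntegrable (fun s => z s i * z s j) volume a b) :
    IntervalIntegrable (fun s => (z s - c) ⬝ᵥ (ρ *ᵥ (z s - c))) volume a b := by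
  refine intervalIntegrable_dotProduct_mulVec ρ fun i j => ?_
  have : (fun s => (z s - c) i * (z s - c) j) =
      fun s => (z s i * z s j - z s i * c j) - (c i * z s j - c i * c j) := by
    ext s; simp only [Pi.sub_apply]; ring
  rw [this]
  exact ((hz2 i j).sub ((intervalIntegrable_apply hz i).mul_const _)).sub
    (((intervalIntegrable_apply hz j).const_mul _).sub intervalIntegrable_const)

/-- Completing the square around the constant path `c`. -/
theorem cost_eq_add_excess (hsymm : ρᵀ = ρ) (c : Vec n) {z : ℝ → Vec n}
    (hz : IntervalIntegrable z volume 0 T)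
    (hz2 : ∀ i j, IntervalIntegrable (fun s => z s i * z s j) volume 0 T) {y : Vec n}
    (hy : y = (2 : ℝ) • c + T • ρ *ᵥ c - ρ *ᵥ ∫ s in (0 : ℝ)..T, z s) :
    (1 / 2) * (y ⬝ᵥ y) + ∫ s in (0 : ℝ)..T, z s ⬝ᵥ (ρ *ᵥ z s) =
      (2 * (c ⬝ᵥ c) + T * (c ⬝ᵥ (ρ *ᵥ c))) + excess T ρ c z := by
  set Z := ∫ s in (0 : ℝ)..T, z s with hZ
  have hlin : ∫ s in (0 : ℝ)..T, (ρ *ᵥ c) ⬝ᵥ z s = (ρ *ᵥ c) ⬝ᵥ Z := by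
    simp only [dotProduct]
    rw [intervalIntegral.integral_finsetSum fun i _ =>
      (intervalIntegrable_apply hz i).const_mul _]
    exact Finset.sum_congr rfl fun i _ => by
      rw [intervalIntegral.integral_const_mul, hZ, intervalIntegral_apply hz]
  have hlinint : IntervalIntegrable (fun s => (ρ *ᵥ c) ⬝ᵥ z s) volume 0 T := by
    have : (fun s => (ρ *ᵥ c) ⬝ᵥ z s) = ∑ i, fun s => (ρ *ᵥ c) i * z s i := by
      ext s; simp [dotProduct]
    rw [this]
    exact IntervalIntegrable.sum _ fun i _ => (intervalIntegrable_apply hz i).const_mul _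
  have hpt : ∀ s, z s ⬝ᵥ (ρ *ᵥ z s) = (z s - c) ⬝ᵥ (ρ *ᵥ (z s - c)) +
      (2 * ((ρ *ᵥ c) ⬝ᵥ z s) - c ⬝ᵥ (ρ *ᵥ c)) := by
    intro s
    rw [Matrix.mulVec_sub, sub_dotProduct, dotProduct_sub, dotProduct_sub,
      dotProduct_mulVec_symm hsymm c (z s), dotProduct_comm (ρ *ᵥ c) (z s)]
    ring
  have hint : ∫ s in (0 : ℝ)..T, z s ⬝ᵥ (ρ *ᵥ z s) =
      (∫ s in (0 : ℝ)..T, (z s - c) ⬝ᵥ (ρ *ᵥ (z s - c))) +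
        (2 * ((ρ *ᵥ c) ⬝ᵥ Z) - T * (c ⬝ᵥ (ρ *ᵥ c))) := by
    simp only [hpt]
    rw [intervalIntegral.integral_add (intervalIntegrable_sub_dotProduct c hz hz2)
      ((hlinint.const_mul 2).sub intervalIntegrable_const),
      intervalIntegral.integral_sub (hlinint.const_mul 2) intervalIntegrable_const,
      intervalIntegral.integral_const_mul, hlin]
    simp
  -- Written around `c`, the terminal value has constant part `2 c`. The cross term `-2 c · ρ (Z - T
  -- c)` of `½ y · y` then cancels the linear term `2 (ρ c) · Z` of the running cost; this dictates
  -- the choice of `c`.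
  have hy' : y = (2 : ℝ) • c - ρ *ᵥ (Z - T • c) := by
    rw [hy, Matrix.mulVec_sub, Matrix.mulVec_smul]
    abel
  have hU : c ⬝ᵥ (ρ *ᵥ (Z - T • c)) = (ρ *ᵥ c) ⬝ᵥ Z - T * (c ⬝ᵥ (ρ *ᵥ c)) := by
    rw [Matrix.mulVec_sub, dotProduct_sub, dotProduct_mulVec_symm hsymm c Z, Matrix.mulVec_smul,
      dotProduct_smul, smul_eq_mul, dotProduct_comm Z]
  rw [hint, excess, ← hZ, hy', sub_dotProduct, dotProduct_sub, dotProduct_sub, smul_dotProduct,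
    smul_dotProduct, dotProduct_smul, dotProduct_smul,
    dotProduct_comm (ρ *ᵥ (Z - T • c)) c, hU]
  simp only [smul_eq_mul]
  ring

theorem dotProduct_mulVec_nonneg (hρ : ρ.PosDef) (v : Vec n) : 0 ≤ v ⬝ᵥ (ρ *ᵥ v) := by
  simpa using hρ.posSemidef.dotProduct_mulVec_nonneg v

theorem eq_zero_of_dotProduct_mulVec (hρ : ρ.PosDef) {v : Vec n} (h : v ⬝ᵥ (ρ *ᵥ v) = 0) :
    v = 0 := by
  by_contra hv
  have := hρ.dotProduct_mulVec_pos hv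
  simp [h] at this

/-- No integrability of `z` is required, since a non-integrable integrand has integral `0` by
convention. The bound thus holds for every `ω`. -/
theorem excess_nonneg (hT : 0 < T) (hρ : ρ.PosDef) (c : Vec n) (z : ℝ → Vec n) :
    0 ≤ excess T ρ c z := by
  refine add_nonneg (mul_nonneg (by norm_num) ?_) ?_
  · exact Finset.sum_nonneg fun i _ => mul_self_nonneg _
  · exact intervalIntegral.integral_nonneg hT.le fun s _ => dotProduct_mulVec_nonneg hρ _

theorem excess_eq_zero_of_ae_eq {c : Vec n} {z : ℝ → Vec n} (hT : 0 < T)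
    (h : ∀ᵐ s ∂(volume : Measure ℝ).restrict (Set.Icc 0 T), z s = c) : excess T ρ c z = 0 := by
  have h' : ∀ᵐ s : ℝ, s ∈ Set.uIoc 0 T → z s = c := by
    filter_upwards [(ae_restrict_iff' measurableSet_Icc).1 h] with s hs hmem
    rw [Set.uIoc_of_le hT.le] at hmem
    exact hs ⟨hmem.1.le, hmem.2⟩
  have h1 : ∫ s in (0 : ℝ)..T, z s = T • c := by
    rw [intervalIntegral.integral_congr_ae h']
    simp
  have h2 : ∫ s in (0 : ℝ)..T, (z s - c) ⬝ᵥ (ρ *ᵥ (z s - c)) = 0 := by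
    rw [intervalIntegral.integral_congr_ae (g := fun _ => (0 : ℝ))]
    · simp
    · filter_upwards [h'] with s hs hmem
      simp [hs hmem]
  rw [excess, h1, h2]
  simp

theorem ae_eq_of_excess_eq_zero (hT : 0 < T) (hρ : ρ.PosDef) {c : Vec n} {z : ℝ → Vec n}
    (hz : IntervalIntegrable z volume 0 T)
    (hz2 : ∀ i j, IntervalIntegrable (fun s => z s i * z s j) volume 0 T)
    (h : excess T ρ c z = 0) :
    ∀ᵐ s ∂(volume : Measure ℝ).restrict (Set.Icc 0 T), z s = c := by
  have h1 : ∫ s in (0 : ℝ)..T, (z s - c) ⬝ᵥ (ρ *ᵥ (z s - c)) = 0 := by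
    have ha : 0 ≤ (ρ *ᵥ ((∫ s in (0 : ℝ)..T, z s) - T • c)) ⬝ᵥ
        (ρ *ᵥ ((∫ s in (0 : ℝ)..T, z s) - T • c)) :=
      Finset.sum_nonneg fun i _ => mul_self_nonneg _
    have hb : 0 ≤ ∫ s in (0 : ℝ)..T, (z s - c) ⬝ᵥ (ρ *ᵥ (z s - c)) :=
      intervalIntegral.integral_nonneg hT.le fun s _ => dotProduct_mulVec_nonneg hρ _
    rw [excess] at h
    linarith
  rw [intervalIntegral.integral_eq_zero_iff_of_le_of_nonneg_ae hT.le
    (ae_of_all _ fun s => dotProduct_mulVec_nonneg hρ _)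
    (intervalIntegrable_sub_dotProduct c hz hz2)] at h1
  rw [Measure.restrict_congr_set Ioc_ae_eq_Icc.symm]
  filter_upwards [h1] with s hs
  exact sub_eq_zero.1 (eq_zero_of_dotProduct_mulVec hρ hs)

end Quadratic

/-! ### The cost of a progressively measurable strategy -/

section Cost

variable {n : ℕ} {O : Mat n} {lam : Vec n} {ρ : Mat n} {T : ℝ} {Ω : Type*}
  {mΩ : MeasurableSpace Ω} {P : Measure Ω} {𝓕 : Filtration (Time T) mΩ} {hT : 0 < T}
  {x d : Vec n} {X : Time T → Ω → Vec n}

theorem zero_le_dotProduct_self (v : Vec n) : 0 ≤ v ⬝ᵥ v :=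
  Finset.sum_nonneg fun _ _ => mul_self_nonneg _

/-- The scaled deviation `γ^{-1/2} D`. -/
noncomputable def scaledDeviation (hT : 0 < T) (O : Mat n) (lam : Vec n) (ρ : Mat n) (x d : Vec n)
    (X : Time T → Ω → Vec n) (ω : Ω) (s : ℝ) : Vec n :=
  impactPow O lam (-(1 / 2)) *ᵥ path hT (deviation hT O lam ρ x d X) ω s

theorem measurable_scaledDeviation (hX : IsStronglyProgressive 𝓕 X) :
    Measurable fun p : Ω × ℝ => scaledDeviation hT O lam ρ x d X p.1 p.2 :=
  measurable_mulVec (A := fun _ => impactPow O lam (-(1 / 2))) (fun _ _ => measurable_const)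
    (measurable_path_deviation hT x d hX)

theorem memLp_scaledDeviation [IsProbabilityMeasure P]
    (hX : IsPMStrategy P hT 𝓕 O lam ρ x d X) (i : Fin n) :
    MemLp (fun p : Ω × ℝ => scaledDeviation hT O lam ρ x d X p.1 p.2 i) 2
      (P.prod ((volume : Measure ℝ).restrict (Set.Icc 0 T))) := by
  have hm := measurable_scaledDeviation (hT := hT) (O := O) (lam := lam) (ρ := ρ) (x := x) (d := d)
    hX.progressive
  have hmi := (measurable_pi_apply i).comp hm
  have hdot := measurable_dotProduct hm hm
  refine (memLp_two_iff_integrable_sq hmi.aestronglyMeasurable).2 ?_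
  have hint : Integrable (fun p : Ω × ℝ => scaledDeviation hT O lam ρ x d X p.1 p.2 ⬝ᵥ
      scaledDeviation hT O lam ρ x d X p.1 p.2)
      (P.prod ((volume : Measure ℝ).restrict (Set.Icc 0 T))) := by
    refine ⟨hdot.aestronglyMeasurable, ?_⟩
    rw [hasFiniteIntegral_iff_ofReal (ae_of_all _ fun p => zero_le_dotProduct_self _), lintegral_prod _
        hdot.ennreal_ofReal.aemeasurable]
    exact hX.deviation_integrable
  refine hint.mono' (hmi.pow_const 2).aestronglyMeasurable (ae_of_all _ fun p => ?_)
  rw [Real.norm_of_nonneg (sq_nonneg _), sq]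
  exact Finset.single_le_sum (f := fun i => scaledDeviation hT O lam ρ x d X p.1 p.2 i *
    scaledDeviation hT O lam ρ x d X p.1 p.2 i) (fun _ _ => mul_self_nonneg _) (Finset.mem_univ i)

theorem integrable_mul_scaledDeviation [IsProbabilityMeasure P]
    (hX : IsPMStrategy P hT 𝓕 O lam ρ x d X) (i j : Fin n) :
    Integrable (fun p : Ω × ℝ => scaledDeviation hT O lam ρ x d X p.1 p.2 i *
      scaledDeviation hT O lam ρ x d X p.1 p.2 j)
      (P.prod ((volume : Measure ℝ).restrict (Set.Icc 0 T))) :=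
  (memLp_scaledDeviation hX i).integrable_mul (memLp_scaledDeviation hX j)

theorem intervalIntegrable_iff_restrict_Icc (hT : 0 < T) {f : ℝ → ℝ} :
    IntervalIntegrable f volume 0 T ↔
      Integrable f ((volume : Measure ℝ).restrict (Set.Icc 0 T)) := by
  rw [intervalIntegrable_iff_integrableOn_Icc_of_le hT.le, IntegrableOn]

theorem ae_intervalIntegrable_mul [IsProbabilityMeasure P]
    (hX : IsPMStrategy P hT 𝓕 O lam ρ x d X) :
    ∀ᵐ ω ∂P, ∀ i j, IntervalIntegrable (fun s => scaledDeviation hT O lam ρ x d X ω s i *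
      scaledDeviation hT O lam ρ x d X ω s j) volume 0 T := by
  refine ae_all_iff.2 fun i => ae_all_iff.2 fun j => ?_
  filter_upwards [(integrable_mul_scaledDeviation hX i j).prod_right_ae] with ω hω
  exact (intervalIntegrable_iff_restrict_Icc hT).2 hω

theorem ae_intervalIntegrable_scaledDeviation [IsProbabilityMeasure P]
    (hX : IsPMStrategy P hT 𝓕 O lam ρ x d X) :
    ∀ᵐ ω ∂P, IntervalIntegrable (scaledDeviation hT O lam ρ x d X ω) volume 0 T := by
  have : ∀ᵐ ω ∂P, ∀ i, IntervalIntegrable (fun s => scaledDeviation hT O lam ρ x d X ω s i)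
      volume 0 T := by
    refine ae_all_iff.2 fun i => ?_
    filter_upwards [((memLp_scaledDeviation hX i).integrable one_le_two).prod_right_ae] with ω hω
    exact (intervalIntegrable_iff_restrict_Icc hT).2 hω
  filter_upwards [this] with ω hω using intervalIntegrable_of_apply hω

theorem ae_intervalIntegrable_path (hX : IsPMStrategy P hT 𝓕 O lam ρ x d X) :
    ∀ᵐ ω ∂P, IntervalIntegrable (path hT X ω) volume 0 T := by
  filter_upwards [hX.square_integrable] with ω hω
  have hm : Measurable (path hT X ω) :=
    (measurable_path hT hX.progressive).comp measurable_prodMk_left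
  have hdot := measurable_dotProduct hm hm
  have hint : Integrable (fun s => path hT X ω s ⬝ᵥ path hT X ω s)
      ((volume : Measure ℝ).restrict (Set.Icc 0 T)) := by
    refine ⟨hdot.aestronglyMeasurable, ?_⟩
    rwa [hasFiniteIntegral_iff_ofReal (ae_of_all _ fun p => zero_le_dotProduct_self _)]
  refine intervalIntegrable_of_apply fun i => (intervalIntegrable_iff_restrict_Icc hT).2 ?_
  have hmi : Measurable fun s => path hT X ω s i := (measurable_pi_apply i).comp hm
  refine ((memLp_two_iff_integrable_sq hmi.aestronglyMeasurable).2 ?_).integrable one_le_two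
  refine hint.mono' (hmi.pow_const 2).aestronglyMeasurable (ae_of_all _ fun s => ?_)
  rw [Real.norm_of_nonneg (sq_nonneg _), sq]
  exact Finset.single_le_sum (f := fun i => path hT X ω s i * path hT X ω s i)
    (fun _ _ => mul_self_nonneg _) (Finset.mem_univ i)

/-- The scaled deviation `γ^{-1/2} D*` of the candidate strategy on `[0, T)`. -/
noncomputable def optimalScaled (T : ℝ) (O : Mat n) (lam : Vec n) (ρ : Mat n) (x d : Vec n) :
    Vec n :=
  impactPow O lam (-(1 / 2)) *ᵥ -(impact O lam *ᵥ optimalVector T O lam ρ x d)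

/-- The equation `(2 I + T ρ) c = γ^{-1/2} (d - γ x)` for the scaled optimal deviation `c`; this is
the form needed for completing the square. -/
theorem impactPow_mulVec_initial (hO : O ∈ Matrix.orthogonalGroup (Fin n) ℝ)
    (hlam : ∀ j, 0 < lam j) (hρ : ρ.PosDef) (hcomm : ρ * impact O lam = impact O lam * ρ)
    (hT : 0 < T) (x d : Vec n) :
    impactPow O lam (-(1 / 2)) *ᵥ (d - impact O lam *ᵥ x) =
      (2 : ℝ) • optimalScaled T O lam ρ x d + T • ρ *ᵥ optimalScaled T O lam ρ x d := by
  rw [← neg_sub, ← two_smul_optimalVector hO hlam hρ hT x d, optimalScaled,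
    Matrix.mulVec_mulVec _ ρ, (commute_impactPow hO hcomm _).eq, ← Matrix.mulVec_mulVec,
    Matrix.mulVec_neg _ ρ, Matrix.mulVec_mulVec _ ρ, hcomm, ← Matrix.mulVec_mulVec]
  simp only [Matrix.mulVec_add, Matrix.mulVec_smul, Matrix.mulVec_neg]
  module

/-- The terminal constraint enters here: with `X(T) = 0` the integrated equation makes `D(T)` an
affine function of `∫ D`, so the cost depends on the scaled deviation path alone. -/
theorem scaledDeviation_end (hO : O ∈ Matrix.orthogonalGroup (Fin n) ℝ)
    (hlam : ∀ j, 0 < lam j) (hρ : ρ.PosDef) (hcomm : ρ * impact O lam = impact O lam * ρ)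
    {ω : Ω} (hpath : IntervalIntegrable (path hT X ω) volume 0 T)
    (hend : X (endTime hT) ω = 0) :
    impactPow O lam (-(1 / 2)) *ᵥ deviation hT O lam ρ x d X (endTime hT) ω =
      (2 : ℝ) • optimalScaled T O lam ρ x d + T • ρ *ᵥ optimalScaled T O lam ρ x d -
        ρ *ᵥ ∫ s in (0 : ℝ)..T, scaledDeviation hT O lam ρ x d X ω s := by
  have hD := intervalIntegrable_pathDeviation (O := O) (lam := lam) (ρ := ρ) x d hpath
  have h0 : path hT X ω T = 0 := by
    rw [← hend]; exact path_coe hT X ω (endTime hT)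
  have h1 : ∫ s in (0 : ℝ)..T, scaledDeviation hT O lam ρ x d X ω s =
      impactPow O lam (-(1 / 2)) *ᵥ
        ∫ s in (0 : ℝ)..T, pathDeviation O lam ρ x d (path hT X ω) s := by
    rw [← intervalIntegral_mulVec _ hD]
    refine intervalIntegral.integral_congr fun s hs => ?_
    rw [Set.uIcc_of_le hT.le] at hs
    simp only [scaledDeviation, path_deviation hT x d X ω hs]
  rw [h1, deviation_eq_pathDeviation, pathDeviation_eq x d hpath (endTime hT).2,
    ← impactPow_mulVec_initial hO hlam hρ hcomm hT]
  simp only [endTime]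
  rw [h0, Matrix.mulVec_zero, zero_add, intervalIntegral_mulVec _ hD, Matrix.mulVec_sub,
    Matrix.mulVec_mulVec _ _ ρ, ← (commute_impactPow hO hcomm _).eq, ← Matrix.mulVec_mulVec]

theorem dotProduct_impactPow_neg_one (hO : O ∈ Matrix.orthogonalGroup (Fin n) ℝ)
    (hlam : ∀ j, 0 < lam j) (v : Vec n) :
    v ⬝ᵥ (impactPow O lam (-1) *ᵥ v) =
      (impactPow O lam (-(1 / 2)) *ᵥ v) ⬝ᵥ (impactPow O lam (-(1 / 2)) *ᵥ v) := by
  have h : impactPow O lam (-1) = impactPow O lam (-(1 / 2)) * impactPow O lam (-(1 / 2)) := by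
    rw [impactPow_mul hO hlam]; norm_num
  rw [h, ← Matrix.mulVec_mulVec, dotProduct_mulVec_symm (transpose_impactPow O lam _)
    v (impactPow O lam (-(1 / 2)) *ᵥ v)]

theorem dotProduct_running (A : Mat n) (hA : Aᵀ = A) (v : Vec n) :
    v ⬝ᵥ ((A * ρ * A) *ᵥ v) = (A *ᵥ v) ⬝ᵥ (ρ *ᵥ (A *ᵥ v)) := by
  rw [Matrix.mul_assoc, ← Matrix.mulVec_mulVec, ← Matrix.mulVec_mulVec,
    dotProduct_mulVec_symm hA v, dotProduct_comm]

theorem integrable_running [IsProbabilityMeasure P]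
    (hX : IsPMStrategy P hT 𝓕 O lam ρ x d X) :
    Integrable (fun ω => ∫ s in (0 : ℝ)..T, scaledDeviation hT O lam ρ x d X ω s ⬝ᵥ
      (ρ *ᵥ scaledDeviation hT O lam ρ x d X ω s)) P := by
  have h : Integrable (fun p : Ω × ℝ => scaledDeviation hT O lam ρ x d X p.1 p.2 ⬝ᵥ
      (ρ *ᵥ scaledDeviation hT O lam ρ x d X p.1 p.2))
      (P.prod ((volume : Measure ℝ).restrict (Set.Icc 0 T))) := by
    simp only [dotProduct, Matrix.mulVec, Finset.mul_sum]
    refine integrable_finsetSum _ fun i _ => integrable_finsetSum _ fun j _ => ?_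
    refine ((integrable_mul_scaledDeviation hX i j).const_mul (ρ i j)).congr
      (ae_of_all _ fun p => ?_)
    ring
  refine h.integral_prod_left.congr (ae_of_all _ fun ω => ?_)
  simp only [intervalIntegral.integral_of_le hT.le, integral_Icc_eq_integral_Ioc]

/-- Admissibility bounds `D` only in `L²` of the product measure, not at time `T`. But `γ^{-1/2}
D(T)` is almost surely affine in the time integral of the scaled deviation, which is square
integrable by `memLp_two_integral_prod`. Without integrability the conditional expectation would be
`0` by convention. -/
theorem integrable_terminal [IsProbabilityMeasure P]
    (hO : O ∈ Matrix.orthogonalGroup (Fin n) ℝ)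
    (hlam : ∀ j, 0 < lam j) (hρ : ρ.PosDef) (hcomm : ρ * impact O lam = impact O lam * ρ)
    (hX : IsPMStrategy P hT 𝓕 O lam ρ x d X) :
    Integrable (fun ω => (impactPow O lam (-(1 / 2)) *ᵥ
      deviation hT O lam ρ x d X (endTime hT) ω) ⬝ᵥ (impactPow O lam (-(1 / 2)) *ᵥ
        deviation hT O lam ρ x d X (endTime hT) ω)) P := by
  set b : Vec n := (2 : ℝ) • optimalScaled T O lam ρ x d + T • ρ *ᵥ optimalScaled T O lam ρ x d
    with hb
  have hV : ∀ i, MemLp (fun ω => ∫ s in Set.Icc 0 T, scaledDeviation hT O lam ρ x d X ω s i) 2 P :=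
    fun i => memLp_two_integral_prod (memLp_scaledDeviation hX i)
  have hW : ∀ i, MemLp (fun ω => b i - ∑ j, ρ i j *
      ∫ s in Set.Icc 0 T, scaledDeviation hT O lam ρ x d X ω s j) 2 P := fun i =>
    (memLp_const _).sub (memLp_finsetSum _ fun j _ => (hV j).const_mul _)
  have hS : Integrable (fun ω => ∑ i, (b i - ∑ j, ρ i j *
      ∫ s in Set.Icc 0 T, scaledDeviation hT O lam ρ x d X ω s j) ^ 2) P :=
    integrable_finsetSum _ fun i _ => (hW i).integrable_sq
  refine hS.congr ?_
  filter_upwards [ae_intervalIntegrable_path hX, hX.terminal,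
    ae_intervalIntegrable_scaledDeviation hX] with ω h1 h2 h3
  rw [scaledDeviation_end hO hlam hρ hcomm h1 h2, ← hb]
  simp only [dotProduct]
  refine Finset.sum_congr rfl fun i _ => ?_
  rw [← sq, Pi.sub_apply]
  simp only [Matrix.mulVec, dotProduct, intervalIntegral_apply h3,
    intervalIntegral.integral_of_le hT.le, integral_Icc_eq_integral_Ioc]

/-- The value of the cost functional at the candidate strategy. -/
noncomputable def optimalCost (T : ℝ) (O : Mat n) (lam : Vec n) (ρ : Mat n) (x d : Vec n) : ℝ :=
  2 * (optimalScaled T O lam ρ x d ⬝ᵥ optimalScaled T O lam ρ x d) +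
    T * (optimalScaled T O lam ρ x d ⬝ᵥ (ρ *ᵥ optimalScaled T O lam ρ x d)) -
    (1 / 2) * (d ⬝ᵥ (impactPow O lam (-1) *ᵥ d))

theorem ae_cost_eq_add_excess [IsProbabilityMeasure P]
    (hO : O ∈ Matrix.orthogonalGroup (Fin n) ℝ)
    (hlam : ∀ j, 0 < lam j) (hρ : ρ.PosDef) (hcomm : ρ * impact O lam = impact O lam * ρ)
    (hX : IsPMStrategy P hT 𝓕 O lam ρ x d X) :
    ∀ᵐ ω ∂P, (1 / 2) * ((impactPow O lam (-(1 / 2)) *ᵥ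
      deviation hT O lam ρ x d X (endTime hT) ω) ⬝ᵥ (impactPow O lam (-(1 / 2)) *ᵥ
        deviation hT O lam ρ x d X (endTime hT) ω)) +
      ∫ s in (0 : ℝ)..T, scaledDeviation hT O lam ρ x d X ω s ⬝ᵥ
        (ρ *ᵥ scaledDeviation hT O lam ρ x d X ω s) =
      (optimalCost T O lam ρ x d + (1 / 2) * (d ⬝ᵥ (impactPow O lam (-1) *ᵥ d))) +
      excess T ρ (optimalScaled T O lam ρ x d) (scaledDeviation hT O lam ρ x d X ω) := by
  filter_upwards [ae_intervalIntegrable_path hX, hX.terminal,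
    ae_intervalIntegrable_scaledDeviation hX, ae_intervalIntegrable_mul hX] with ω h1 h2 h3 h4
  rw [cost_eq_add_excess (transpose_eq_of_posDef hρ) (optimalScaled T O lam ρ x d) h3 h4
    (scaledDeviation_end hO hlam hρ hcomm h1 h2), optimalCost, sub_add_cancel]

theorem integrable_excess [IsProbabilityMeasure P]
    (hO : O ∈ Matrix.orthogonalGroup (Fin n) ℝ)
    (hlam : ∀ j, 0 < lam j) (hρ : ρ.PosDef) (hcomm : ρ * impact O lam = impact O lam * ρ)
    (hX : IsPMStrategy P hT 𝓕 O lam ρ x d X) :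
    Integrable (fun ω => excess T ρ (optimalScaled T O lam ρ x d)
      (scaledDeviation hT O lam ρ x d X ω)) P := by
  refine ((((integrable_terminal hO hlam hρ hcomm hX).const_mul (1 / 2)).add
    (integrable_running hX)).sub (integrable_const (optimalCost T O lam ρ x d +
      (1 / 2) * (d ⬝ᵥ (impactPow O lam (-1) *ᵥ d))))).congr ?_
  filter_upwards [ae_cost_eq_add_excess hO hlam hρ hcomm hX] with ω h
  simp only [Pi.sub_apply, Pi.add_apply]
  rw [h, add_sub_cancel_left]

/-- The cost of a strategy is the optimal cost plus the conditional expectation of its excess. -/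
theorem costPM_ae_eq [IsProbabilityMeasure P]
    (hO : O ∈ Matrix.orthogonalGroup (Fin n) ℝ)
    (hlam : ∀ j, 0 < lam j) (hρ : ρ.PosDef) (hcomm : ρ * impact O lam = impact O lam * ρ)
    (hX : IsPMStrategy P hT 𝓕 O lam ρ x d X) :
    costPM P hT 𝓕 O lam ρ x d X =ᵐ[P] fun ω => optimalCost T O lam ρ x d +
      (P[fun ω => excess T ρ (optimalScaled T O lam ρ x d)
        (scaledDeviation hT O lam ρ x d X ω) | 𝓕 (startTime hT)]) ω := by
  set K := optimalCost T O lam ρ x d + (1 / 2) * (d ⬝ᵥ (impactPow O lam (-1) *ᵥ d)) with hK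
  have hterm := integrable_terminal hO hlam hρ hcomm hX
  have hrun := integrable_running hX
  have hexc := integrable_excess hO hlam hρ hcomm hX
  set f := fun ω => (impactPow O lam (-(1 / 2)) *ᵥ
      deviation hT O lam ρ x d X (endTime hT) ω) ⬝ᵥ (impactPow O lam (-(1 / 2)) *ᵥ
        deviation hT O lam ρ x d X (endTime hT) ω)
  set g := fun ω => ∫ s in (0 : ℝ)..T, scaledDeviation hT O lam ρ x d X ω s ⬝ᵥ
      (ρ *ᵥ scaledDeviation hT O lam ρ x d X ω s)
  set R := fun ω => excess T ρ (optimalScaled T O lam ρ x d)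
      (scaledDeviation hT O lam ρ x d X ω)
  have hf : (fun ω => deviation hT O lam ρ x d X (endTime hT) ω ⬝ᵥ
      (impactPow O lam (-1) *ᵥ deviation hT O lam ρ x d X (endTime hT) ω)) = f :=
    funext fun ω => dotProduct_impactPow_neg_one hO hlam _
  have hg : (fun ω => ∫ s in (0 : ℝ)..T, path hT (deviation hT O lam ρ x d X) ω s ⬝ᵥ
      ((impactPow O lam (-(1 / 2)) * kappa O lam ρ * impactPow O lam (-(1 / 2))) *ᵥ
        path hT (deviation hT O lam ρ x d X) ω s)) = g := by
    ext ω
    rw [kappa_eq hO hlam hcomm (transpose_eq_of_posDef hρ)]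
    exact intervalIntegral.integral_congr fun s _ =>
      dotProduct_running _ (transpose_impactPow O lam _) _
  have hfg : ((1 / 2 : ℝ) • f + g) =ᵐ[P] (fun _ => K) + R := by
    filter_upwards [ae_cost_eq_add_excess hO hlam hρ hcomm hX] with ω h
    exact h
  have hm := 𝓕.le (startTime hT)
  filter_upwards [condExp_congr_ae (m := 𝓕 (startTime hT)) hfg,
    condExp_add (hterm.smul (1 / 2 : ℝ)) hrun (𝓕 (startTime hT)),
    condExp_add (integrable_const K) hexc (𝓕 (startTime hT)),
    condExp_smul (1 / 2 : ℝ) f (𝓕 (startTime hT)) (μ := P)] with ω h1 h2 h3 h4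
  rw [costPM]
  simp only [hf, hg]
  rw [h2, h3, Pi.add_apply, Pi.add_apply, h4, condExp_const hm] at h1
  simp only [Pi.smul_apply, smul_eq_mul] at h1
  rw [h1, hK]
  ring

theorem excess_optimalStrategy (hO : O ∈ Matrix.orthogonalGroup (Fin n) ℝ)
    (hlam : ∀ j, 0 < lam j) (hρ : ρ.PosDef) (hcomm : ρ * impact O lam = impact O lam * ρ)
    (ω : Ω) :
    excess T ρ (optimalScaled T O lam ρ x d)
      (scaledDeviation hT O lam ρ x d (optimalStrategy Ω O lam ρ x d) ω) = 0 := by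
  refine excess_eq_zero_of_ae_eq hT ?_
  filter_upwards [ae_restrict_mem measurableSet_Icc, ae_restrict_of_ae (ae_ne_endpoint T)]
    with s hs hne
  rw [scaledDeviation, path_of_mem hT _ ω hs, deviation_optimalStrategy hO hlam hρ hcomm,
    if_pos (lt_of_le_of_ne hs.2 hne), optimalScaled]

theorem costPM_optimalStrategy [IsProbabilityMeasure P]
    (hO : O ∈ Matrix.orthogonalGroup (Fin n) ℝ)
    (hlam : ∀ j, 0 < lam j) (hρ : ρ.PosDef) (hcomm : ρ * impact O lam = impact O lam * ρ) :
    costPM P hT 𝓕 O lam ρ x d (optimalStrategy Ω O lam ρ x d) =ᵐ[P]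
      fun _ => optimalCost T O lam ρ x d := by
  have h := costPM_ae_eq hO hlam hρ hcomm
    (isPMStrategy_optimalStrategy P hO hlam hρ hcomm hT 𝓕 x d)
  simp only [excess_optimalStrategy hO hlam hρ hcomm] at h
  filter_upwards [h] with ω hω
  rw [hω, condExp_const (𝓕.le _), add_zero]

theorem isOptimalPM_optimalStrategy [IsProbabilityMeasure P]
    (hO : O ∈ Matrix.orthogonalGroup (Fin n) ℝ)
    (hlam : ∀ j, 0 < lam j) (hρ : ρ.PosDef) (hcomm : ρ * impact O lam = impact O lam * ρ) :
    IsOptimalPM P hT 𝓕 O lam ρ x d (optimalStrategy Ω O lam ρ x d) := by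
  refine ⟨isPMStrategy_optimalStrategy P hO hlam hρ hcomm hT 𝓕 x d, fun Y hY => ?_⟩
  filter_upwards [costPM_optimalStrategy (P := P) (𝓕 := 𝓕) (hT := hT) (x := x) (d := d)
    hO hlam hρ hcomm, costPM_ae_eq hO hlam hρ hcomm hY,
    condExp_nonneg (m := 𝓕 (startTime hT)) (μ := P) (ae_of_all P fun ω =>
      excess_nonneg hT hρ (optimalScaled T O lam ρ x d) (scaledDeviation hT O lam ρ x d Y ω))]
    with ω h1 h2 h3
  rw [h1, h2]
  exact le_add_of_nonneg_right h3

/-- The scaled deviation of an optimal strategy is constant. -/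
theorem ae_scaledDeviation_eq_of_isOptimalPM [IsProbabilityMeasure P]
    (hO : O ∈ Matrix.orthogonalGroup (Fin n) ℝ)
    (hlam : ∀ j, 0 < lam j) (hρ : ρ.PosDef) (hcomm : ρ * impact O lam = impact O lam * ρ)
    (hX : IsOptimalPM P hT 𝓕 O lam ρ x d X) :
    ∀ᵐ ω ∂P, ∀ᵐ s ∂(volume : Measure ℝ).restrict (Set.Icc 0 T),
      scaledDeviation hT O lam ρ x d X ω s = optimalScaled T O lam ρ x d := by
  have hle := hX.2 _ (isPMStrategy_optimalStrategy P hO hlam hρ hcomm hT 𝓕 x d)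
  have hexc := integrable_excess hO hlam hρ hcomm hX.1
  have hnn := fun ω => excess_nonneg hT hρ (optimalScaled T O lam ρ x d)
    (scaledDeviation hT O lam ρ x d X ω)
  have hcond : (P[fun ω => excess T ρ (optimalScaled T O lam ρ x d)
      (scaledDeviation hT O lam ρ x d X ω) | 𝓕 (startTime hT)]) ≤ᵐ[P] 0 := by
    filter_upwards [hle, costPM_optimalStrategy (P := P) (𝓕 := 𝓕) (hT := hT) (x := x) (d := d)
      hO hlam hρ hcomm, costPM_ae_eq hO hlam hρ hcomm hX.1] with ω h1 h2 h3
    rw [h2, h3] at h1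
    simpa using h1
  -- Comparison with the candidate makes the conditional expectation of the excess nonpositive.
  -- Taking expectations and using nonnegativity, the excess has mean zero and so vanishes almost
  -- surely.
  have hint : ∫ ω, excess T ρ (optimalScaled T O lam ρ x d)
      (scaledDeviation hT O lam ρ x d X ω) ∂P = 0 := by
    refine le_antisymm ?_ (integral_nonneg hnn)
    rw [← integral_condExp (𝓕.le (startTime hT))]
    exact integral_nonpos_of_ae hcond
  have hzero := (integral_eq_zero_iff_of_nonneg hnn hexc).1 hint
  filter_upwards [hzero, ae_intervalIntegrable_scaledDeviation hX.1,
    ae_intervalIntegrable_mul hX.1] with ω h1 h2 h3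
  exact ae_eq_of_excess_eq_zero hT hρ h2 h3 h1

/-- A path is determined almost everywhere by its scaled deviation. -/
theorem path_ae_eq_of_scaledDeviation_ae_eq (hO : O ∈ Matrix.orthogonalGroup (Fin n) ℝ)
    (hlam : ∀ j, 0 < lam j) {X Y : Time T → Ω → Vec n} {ω : Ω}
    (hX : IntervalIntegrable (path hT X ω) volume 0 T)
    (hY : IntervalIntegrable (path hT Y ω) volume 0 T)
    (h : ∀ᵐ s ∂(volume : Measure ℝ).restrict (Set.Icc 0 T),
      scaledDeviation hT O lam ρ x d X ω s = scaledDeviation hT O lam ρ x d Y ω s) :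
    ∀ᵐ s ∂(volume : Measure ℝ).restrict (Set.Icc 0 T), path hT X ω s = path hT Y ω s := by
  have hdev : ∀ᵐ s ∂(volume : Measure ℝ).restrict (Set.Icc 0 T),
      pathDeviation O lam ρ x d (path hT X ω) s = pathDeviation O lam ρ x d (path hT Y ω) s := by
    filter_upwards [h, ae_restrict_mem measurableSet_Icc] with s hs hmem
    have := congrArg (fun v => impactPow O lam (1 / 2) *ᵥ v) hs
    simpa only [scaledDeviation, path_deviation hT x d _ ω hmem, Matrix.mulVec_mulVec,
      impactPow_mul hO hlam, add_neg_cancel, impactPow_zero hO, Matrix.one_mulVec] using this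
  have hdev' := (ae_restrict_iff' measurableSet_Icc).1 hdev
  filter_upwards [hdev, ae_restrict_mem measurableSet_Icc] with s hs hmem
  -- In the integrated equation the integral involves only the deviation, so equal deviations leave
  -- equal `γ X(s)`, and `γ` is invertible.
  have hint : ∫ u in (0 : ℝ)..s, ρ *ᵥ pathDeviation O lam ρ x d (path hT X ω) u =
      ∫ u in (0 : ℝ)..s, ρ *ᵥ pathDeviation O lam ρ x d (path hT Y ω) u := by
    refine intervalIntegral.integral_congr_ae ?_
    filter_upwards [hdev'] with u hu humem
    rw [Set.uIoc_of_le hmem.1] at humem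
    rw [hu ⟨humem.1.le, humem.2.trans hmem.2⟩]
  rw [pathDeviation_eq x d hX hmem, pathDeviation_eq x d hY hmem, hint] at hs
  have h1 : impact O lam *ᵥ path hT X ω s = impact O lam *ᵥ path hT Y ω s := by
    simpa using hs
  have := congrArg (fun v => impactPow O lam (-1) *ᵥ v) h1
  simpa only [← impactPow_one, Matrix.mulVec_mulVec, impactPow_mul hO hlam, neg_add_cancel,
    impactPow_zero hO, Matrix.one_mulVec] using this

/-- Optimal strategies are unique up to null sets. -/
theorem path_ae_eq_of_isOptimalPM [IsProbabilityMeasure P]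
    (hO : O ∈ Matrix.orthogonalGroup (Fin n) ℝ)
    (hlam : ∀ j, 0 < lam j) (hρ : ρ.PosDef) (hcomm : ρ * impact O lam = impact O lam * ρ)
    {X Y : Time T → Ω → Vec n} (hX : IsOptimalPM P hT 𝓕 O lam ρ x d X)
    (hY : IsOptimalPM P hT 𝓕 O lam ρ x d Y) :
    ∀ᵐ p ∂(P.prod ((volume : Measure ℝ).restrict (Set.Icc 0 T))),
      path hT X p.1 p.2 = path hT Y p.1 p.2 := by
  have hms : MeasurableSet {p : Ω × ℝ | path hT X p.1 p.2 = path hT Y p.1 p.2} :=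
    measurableSet_eq_fun (measurable_path hT hX.1.progressive)
      (measurable_path hT hY.1.progressive)
  -- Joint measurability of the set of agreement allows passing from almost every path to the
  -- product measure.
  refine (Measure.ae_prod_mem_iff_ae_ae_mem hms).2 ?_
  filter_upwards [ae_scaledDeviation_eq_of_isOptimalPM hO hlam hρ hcomm hX,
    ae_scaledDeviation_eq_of_isOptimalPM hO hlam hρ hcomm hY,
    ae_intervalIntegrable_path hX.1, ae_intervalIntegrable_path hY.1] with ω h1 h2 h3 h4
  refine path_ae_eq_of_scaledDeviation_ae_eq (ρ := ρ) (x := x) (d := d) hO hlam h3 h4 ?_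
  filter_upwards [h1, h2] with s hs hs'
  rw [hs, hs']

end Cost

end ObizhaevaWang

open MeasureTheory ObizhaevaWang in
open scoped Matrix in
theorem mainTheorem11 {Ω : Type*} {mΩ : MeasurableSpace Ω} (P : Measure Ω)
    [IsProbabilityMeasure P] {T : ℝ} (hT : 0 < T) {n m : ℕ}
    (𝓕 : Filtration (Time T) mΩ) (W : Time T → Ω → Vec m)
    (hW : IsBrownianMotion P hT 𝓕 W) (h𝓕 : IsAugmentedNaturalFiltration P 𝓕 W)
    (O : Mat n) (hO : O ∈ Matrix.orthogonalGroup (Fin n) ℝ)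
    (lam : Vec n) (hlam : ∀ j, 0 < lam j)
    (ρ : Mat n) (hρ : ρ.PosDef) (hcomm : ρ * impact O lam = impact O lam * ρ)
    (x d : Vec n) (hd : d ≠ impact O lam *ᵥ x) :
    ∃ X : Time T → Ω → Vec n,
      IsOptimalPM P hT 𝓕 O lam ρ x d X ∧
      (∀ Y, IsOptimalPM P hT 𝓕 O lam ρ x d Y →
        ∀ᵐ p ∂(P.prod ((volume : Measure ℝ).restrict (Set.Icc 0 T))),
          path hT Y p.1 p.2 = path hT X p.1 p.2) ∧
      IsFVStrategy P hT 𝓕 O lam ρ x d X ∧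
      IsDeviationFV hT 𝓕 O lam ρ x d X (deviation hT O lam ρ x d X) ∧
      (∀ (s : Time T) (ω : Ω), (s : ℝ) < T →
        X s ω = (1 + (T - (s : ℝ)) • ρ) *ᵥ
          (((2 : ℝ) • (1 : Mat n) + T • ρ)⁻¹ *ᵥ (x - impactPow O lam (-1) *ᵥ d))) ∧
      (∀ (s : Time T) (ω : Ω), (s : ℝ) < T →
        deviation hT O lam ρ x d X s ω =
          impactPow O lam (1 / 2) *ᵥ (((2 : ℝ) • (1 : Mat n) + T • ρ)⁻¹ *ᵥ
            (impactPow O lam (-(1 / 2)) *ᵥ d - impactPow O lam (1 / 2) *ᵥ x))) ∧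
      (∀ ω : Ω,
        deviation hT O lam ρ x d X (endTime hT) ω =
          (2 : ℝ) • (impactPow O lam (1 / 2) *ᵥ (((2 : ℝ) • (1 : Mat n) + T • ρ)⁻¹ *ᵥ
            (impactPow O lam (-(1 / 2)) *ᵥ d - impactPow O lam (1 / 2) *ᵥ x)))) := by
  refine ⟨optimalStrategy Ω O lam ρ x d, isOptimalPM_optimalStrategy hO hlam hρ hcomm,
    fun Y hY => path_ae_eq_of_isOptimalPM hO hlam hρ hcomm hY
      (isOptimalPM_optimalStrategy hO hlam hρ hcomm),
    isFVStrategy_optimalStrategy P hO hlam hρ hcomm hT 𝓕 x d,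
    isDeviationFV_optimalStrategy hO hlam hρ hcomm hT 𝓕 x d, fun s ω hs => ?_, fun s ω hs => ?_,
    fun ω => ?_⟩
  · rw [optimalStrategy, if_pos hs, optimalVector]
  · rw [deviation_optimalStrategy hO hlam hρ hcomm, if_pos hs,
      neg_impact_mulVec_optimalVector hO hlam hρ hcomm hT]
  · rw [deviation_optimalStrategy hO hlam hρ hcomm, if_neg (by simp [endTime]),
      neg_impact_mulVec_optimalVector hO hlam hρ hcomm hT]
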